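/- Let $(M,g)$ be a smooth Riemannian manifold (finite-dimensional, without boundary) with Levi-Civita connection $\nabla$, and let $f\colon M\to(0,\infty)$ be a smooth function whose gradient vanishes nowhere. Put $\alpha = 1+\|\operatorname{grad} f\|^2$. Equip the tangent bundle $TM$ with the Mus-Gradient metric $g^f$, that is, the Riemannian metric determined at each point $(x,u)\in TM$ by $$g^f(X^H,Y^H)=g_x(X,Y),\qquad g^f(X^H,Y^V)=0,\qquad g^f(X^V,Y^V)=g_x(X,Y)+X_x(f)\,Y_x(f)$$ for $X,Y\in T_xM$, where in the coordinates $(x^i,y^i)$ on $TM$ induced by coordinates $(x^i)$ on $M$ the vertical and horizontal lifts to $(x,u)$ are $X^V=X^i\frac{\partial}{\partial y^i}$ and $X^H=X^i\big(\frac{\partial}{\partial x^i}-u^j\Gamma_{ij}^k\frac{\partial}{\partial y^k}\big)$, with $\Gamma_{ij}^k$ the Christoffel symbols of $g$. A smooth map $\varphi\colon(P,k)\to(N,h)$ between Riemannian manifolds is called biharmonic if its bitension field $$\tau_2(\varphi)=-\operatorname{Tr}_k R^N(\tau(\varphi),d\varphi)d\varphi-\operatorname{Tr}_k\big(\nabla^\varphi\nabla^\varphi\tau(\varphi)-\nabla^\varphi_{\nabla^P}\tau(\varphi)\big)$$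 vanishes identically, where $\tau(\varphi)=\operatorname{Tr}_k\nabla d\varphi$ is the tension field, $\nabla^\varphi$ is the pull-back connection, and $R^N(X,Y)Z=\nabla_X\nabla_YZ-\nabla_Y\nabla_XZ-\nabla_{[X,Y]}Z$. Then the canonical projection $\pi\colon(TM,g^f)\to(M,g)$ is biharmonic if and only if $$\operatorname{Ricci}(\operatorname{grad}\ln\alpha)+\tfrac12\operatorname{grad}(\Delta\ln\alpha)+\tfrac18\operatorname{grad}\big(\|\operatorname{grad}\ln\alpha\|^2\big)=0\quad\text{on } M,$$ where $\operatorname{Ricci}(X)=\sum_i R(X,E_i)E_i$ for an orthonormal frame $(E_i)$ of $(M,g)$ and $\Delta=\operatorname{div}\operatorname{grad}$. -/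

import Mathlib

open scoped Manifold ContDiff
open Bundle

set_option maxSynthPendingDepth 3

noncomputable section

/-! ## Tensor calculus in a coordinate domain

`E` and `F` are the spaces in which coordinates take their values. `G : E → E →L[ℝ] E →L[ℝ] ℝ` is a
metric written in coordinates. The coordinate expression of a vector field is a map into `E`.
-/

namespace LocalGeometry

variable {E : Type*} [NormedAddCommGroup E] [NormedSpace ℝ E]
  {F : Type*} [NormedAddCommGroup F] [NormedSpace ℝ F]

/-- The Christoffel symbols `Γ = christoffel G y` of `G` at `y`, as a bilinear map: `Γ u v` is the
vector with `2 G(Γ u v, w) = (∂_u G)(v, w) + (∂_v G)(u, w) - (∂_w G)(u, v)` for all `w`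
(see `two_mul_metric_christoffel`); in indices, `(Γ u v)^k = Γ_{ij}^k u^i v^j`. -/
def christoffel (G : E → E →L[ℝ] E →L[ℝ] ℝ) (y : E) : E →L[ℝ] E →L[ℝ] E :=
  let D : E →L[ℝ] E →L[ℝ] E →L[ℝ] ℝ := fderiv ℝ G y
  -- `D₂₁ u v w = D v u w` and `D₃ u v w = D w u v`
  let D₂₁ : E →L[ℝ] E →L[ℝ] E →L[ℝ] ℝ := D.flip
  let D₃ : E →L[ℝ] E →L[ℝ] E →L[ℝ] ℝ :=
    (ContinuousLinearMap.flipₗᵢ ℝ E E ℝ).toContinuousLinearEquiv.toContinuousLinearMap ∘L D.flip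
  let S : E →L[ℝ] (E →L[ℝ] (E →L[ℝ] ℝ)) := (1 / 2 : ℝ) • (D + D₂₁ - D₃)
  (ContinuousLinearMap.compL ℝ E (E →L[ℝ] ℝ) E (G y).inverse) ∘L S

theorem two_mul_metric_christoffel {G : E → E →L[ℝ] E →L[ℝ] ℝ} {y : E}
    (hG : (G y).IsInvertible) (u v w : E) :
    2 * G y (christoffel G y u v) w
      = fderiv ℝ G y u v w + fderiv ℝ G y v u w - fderiv ℝ G y w u v := by
  have h : ∀ ξ : E →L[ℝ] ℝ, G y ((G y).inverse ξ) = ξ := by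
    intro ξ
    obtain ⟨e, he⟩ := hG
    rw [← he, ContinuousLinearMap.inverse_equiv]
    simp
  simp only [christoffel, ContinuousLinearMap.comp_apply, ContinuousLinearMap.compL_apply, h]
  simp

/-- The curvature `R(u, v) w = ∇_u ∇_v w - ∇_v ∇_u w - ∇_{[u, v]} w` of the Levi-Civita connection
of `G` at `y` (computed on coordinate fields, i.e. constant `u`, `v`, `w`). -/
def curvature (G : E → E →L[ℝ] E →L[ℝ] ℝ) (y u v w : E) : E :=
  fderiv ℝ (christoffel G) y u v w - fderiv ℝ (christoffel G) y v u w
    + christoffel G y u (christoffel G y v w) - christoffel G y v (christoffel G y u w)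

/-- The trace of a bilinear map `B` with respect to an inner product `b`; in indices,
`b^{ij} B(e_i, e_j)`. If `(e_i)` is `b`-orthonormal this is `∑ B(e_i, e_i)`. -/
def metricTrace [FiniteDimensional ℝ E] (b : E →L[ℝ] E →L[ℝ] ℝ) (B : E → E → F) : F :=
  ∑ i, B (Module.finBasis ℝ E i)
    (b.inverse (LinearMap.toContinuousLinearMap ((Module.finBasis ℝ E).coord i)))

/-- The Ricci endomorphism `v ↦ ∑ R(v, e_i) e_i`, with `(e_i)` a `G y`-orthonormal basis. -/
def ricci [FiniteDimensional ℝ E] (G : E → E →L[ℝ] E →L[ℝ] ℝ) (y v : E) : E :=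
  metricTrace (G y) fun u w ↦ curvature G y v u w

/-- The Laplace-Beltrami operator `Δ k = Tr_G (∇ dk)`. -/
def laplacian [FiniteDimensional ℝ E] (G : E → E →L[ℝ] E →L[ℝ] ℝ) (k : E → ℝ) (y : E) : ℝ :=
  metricTrace (G y) fun u w ↦
    fderiv ℝ (fderiv ℝ k) y u w - fderiv ℝ k y (christoffel G y u w)

/-- The tension field `Tr_G (∇ dφ)` of a map `φ` from `(E, G)` to `(F, K)`. -/
def tension [FiniteDimensional ℝ E] (G : E → E →L[ℝ] E →L[ℝ] ℝ) (K : F → F →L[ℝ] F →L[ℝ] ℝ)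
    (φ : E → F) (y : E) : F :=
  metricTrace (G y) fun u w ↦
    fderiv ℝ (fderiv ℝ φ) y u w + christoffel K (φ y) (fderiv ℝ φ y u) (fderiv ℝ φ y w)
      - fderiv ℝ φ y (christoffel G y u w)

/-- The pull-back covariant derivative `∇^φ_u V` at `y` of a vector field `V` along `φ`. -/
def covDerivAlong (K : F → F →L[ℝ] F →L[ℝ] ℝ) (φ V : E → F) (y u : E) : F :=
  fderiv ℝ V y u + christoffel K (φ y) (fderiv ℝ φ y u) (V y)

/-- `Tr_G (∇^φ ∇^φ V - ∇^φ_{∇} V)` for a vector field `V` along `φ`. -/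
def roughLaplacian [FiniteDimensional ℝ E] (G : E → E →L[ℝ] E →L[ℝ] ℝ)
    (K : F → F →L[ℝ] F →L[ℝ] ℝ) (φ V : E → F) (y : E) : F :=
  metricTrace (G y) fun u w ↦
    covDerivAlong K φ (fun z ↦ covDerivAlong K φ V z w) y u
      - covDerivAlong K φ V y (christoffel G y u w)

/-- The Jacobi operator
`J_φ(V) = - Tr_G R^K(V, dφ) dφ - Tr_G (∇^φ ∇^φ V - ∇^φ_{∇} V)`. -/
def jacobi [FiniteDimensional ℝ E] (G : E → E →L[ℝ] E →L[ℝ] ℝ)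
    (K : F → F →L[ℝ] F →L[ℝ] ℝ) (φ V : E → F) (y : E) : F :=
  - metricTrace (G y) (fun u w ↦
      curvature K (φ y) (V y) (fderiv ℝ φ y u) (fderiv ℝ φ y w))
    - roughLaplacian G K φ V y

end LocalGeometry

/-! ## Manifolds with a metric

The notions below are those of differential geometry for manifolds without boundary.

Mathlib's `TangentSpace I x` is the model space `E`, a tangent vector at `x` being identified with
its components in the preferred chart `extChartAt I x` at `x`. Below, an element of `E` that is
computed in the preferred chart at `x` is therefore a tangent vector at `x`.
-/

section Manifold

variable {E : Type*} [NormedAddCommGroup E] [NormedSpace ℝ E]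
  {H : Type*} [TopologicalSpace H] {I : ModelWithCorners ℝ E H}
  {M : Type*} [TopologicalSpace M] [ChartedSpace H M]
  {F : Type*} [NormedAddCommGroup F] [NormedSpace ℝ F]
  {H' : Type*} [TopologicalSpace H'] {J : ModelWithCorners ℝ F H'}
  {N : Type*} [TopologicalSpace N] [ChartedSpace H' N]

variable (I M) in
/-- A field of bilinear forms on the tangent spaces of `M`. -/
abbrev BilinField := ∀ x : M, TangentSpace I x →L[ℝ] TangentSpace I x →L[ℝ] ℝ

/-- The expression of `g` in the preferred chart at `x₀`: its value at `y` is the bilinear form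
`(u, v) ↦ g(dψ u, dψ v)`, where `ψ` is the inverse of the chart. -/
def metricInChart (g : BilinField I M) (x₀ : M) (y : E) : E →L[ℝ] E →L[ℝ] ℝ :=
  let L : E →L[ℝ] E := mfderivWithin 𝓘(ℝ, E) I (extChartAt I x₀).symm (Set.range I) y
  let b : E →L[ℝ] E →L[ℝ] ℝ := g ((extChartAt I x₀).symm y)
  b.bilinearComp L L

theorem metricInChart_apply (g : BilinField I M) (x₀ : M) (y u v : E) :
    metricInChart g x₀ y u v = g ((extChartAt I x₀).symm y)
      (mfderivWithin 𝓘(ℝ, E) I (extChartAt I x₀).symm (Set.range I) y u)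
      (mfderivWithin 𝓘(ℝ, E) I (extChartAt I x₀).symm (Set.range I) y v) := rfl

/-- The gradient of a function: `g(grad k, v) = dk(v)`. -/
def grad (g : BilinField I M) (k : M → ℝ) (x : M) : TangentSpace I x :=
  (g x).inverse (mvfderiv I k x)

/-- `‖grad k‖²` -/
def gradNormSq (g : BilinField I M) (k : M → ℝ) (x : M) : ℝ :=
  g x (grad g k x) (grad g k x)

/-- The Laplace-Beltrami operator `Δ k = div grad k = Tr_g (∇ dk)`. -/
def laplacian [FiniteDimensional ℝ E] (g : BilinField I M) (k : M → ℝ) (x : M) : ℝ :=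
  LocalGeometry.laplacian (metricInChart g x) (k ∘ (extChartAt I x).symm) (extChartAt I x x)

/-- The Ricci endomorphism `v ↦ ∑ R(v, e_i) e_i` of `T_x M`. -/
def ricci [FiniteDimensional ℝ E] (g : BilinField I M) (x : M) (v : TangentSpace I x) :
    TangentSpace I x :=
  LocalGeometry.ricci (E := E) (metricInChart g x) (extChartAt I x x) v

/-- The tension field `τ(φ) = Tr_g ∇dφ` of `φ : (M, g) → (N, h)`, a vector field along `φ`. -/
def tension [FiniteDimensional ℝ E] (g : BilinField I M) (h : BilinField J N) (φ : M → N) (x : M) :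
    TangentSpace J (φ x) :=
  LocalGeometry.tension (E := E) (F := F) (metricInChart g x) (metricInChart h (φ x))
    (writtenInExtChartAt I J x φ) (extChartAt I x x)

variable (I J) in
/-- The components of a vector field `V` along `φ`, in the preferred charts at `x₀` and `φ x₀`. -/
def alongInChart (φ : M → N) (V : ∀ x, TangentSpace J (φ x)) (x₀ : M) (y : E) : F :=
  mfderiv J 𝓘(ℝ, F) (extChartAt J (φ x₀)) (φ ((extChartAt I x₀).symm y))
    (V ((extChartAt I x₀).symm y))

/-- The Jacobi operator
`J_φ(V) = - Tr_g R^N(V, dφ) dφ - Tr_g (∇^φ ∇^φ V - ∇^φ_{∇^M} V)` of `φ : (M, g) → (N, h)`, acting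
on vector fields along `φ`. -/
def jacobi [FiniteDimensional ℝ E] (g : BilinField I M) (h : BilinField J N) (φ : M → N)
    (V : ∀ x, TangentSpace J (φ x)) (x : M) : TangentSpace J (φ x) :=
  LocalGeometry.jacobi (E := E) (F := F) (metricInChart g x) (metricInChart h (φ x))
    (writtenInExtChartAt I J x φ) (alongInChart I J φ V x) (extChartAt I x x)

/-- The bitension field `τ₂(φ) = J_φ(τ(φ))`. -/
def bitension [FiniteDimensional ℝ E] (g : BilinField I M) (h : BilinField J N) (φ : M → N)
    (x : M) : TangentSpace J (φ x) :=
  jacobi g h φ (tension g h φ) x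

/-- `φ : (M, g) → (N, h)` is biharmonic: it is smooth and its bitension field vanishes. -/
def IsBiharmonic [FiniteDimensional ℝ E] (g : BilinField I M) (h : BilinField J N)
    (φ : M → N) : Prop :=
  ContMDiff I J ∞ φ ∧ ∀ x, bitension g h φ x = 0

end Manifold

/-! ## The Mus-Gradient metric

The preferred chart of `TM` at `p = (x, u)` is the chart `(x^i, y^i)` that is induced by the preferred
chart of `M` at `x`. In it a tangent vector of `TM` at `p` is a pair `(a, b) : E × E`, which stands for
`a^i ∂/∂x^i + b^i ∂/∂y^i`.
-/

section MusGradient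

variable {E : Type*} [NormedAddCommGroup E] [NormedSpace ℝ E]
  {H : Type*} [TopologicalSpace H] {I : ModelWithCorners ℝ E H}
  {M : Type*} [TopologicalSpace M] [ChartedSpace H M] [IsManifold I ∞ M]

/-- The Christoffel symbols at `x` of `g`, in the preferred chart at `x`. -/
def christoffelAt (g : BilinField I M) (x : M) : E →L[ℝ] E →L[ℝ] E :=
  LocalGeometry.christoffel (metricInChart g x) (extChartAt I x x)

/-- The vertical lift `X^V = X^i ∂/∂y^i` to `p`. -/
def verticalLift (p : TangentBundle I M) (X : TangentSpace I p.proj) : TangentSpace I.tangent p :=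
  ((0, X) : E × E)

/-- The horizontal lift `X^H = X^i (∂/∂x^i - y^j Γ_{ij}^k ∂/∂y^k)` to `p`. -/
def horizontalLift (g : BilinField I M) (p : TangentBundle I M) (X : TangentSpace I p.proj) :
    TangentSpace I.tangent p :=
  ((X, - christoffelAt g p.proj X p.snd) : E × E)

/-- The map `X^H + Y^V ↦ X`, i.e. the differential of the projection `TM → M`. -/
def horizontalPart (p : TangentBundle I M) : TangentSpace I.tangent p →L[ℝ] TangentSpace I p.proj :=
  (ContinuousLinearMap.fst ℝ E E : E × E →L[ℝ] E)

open Set in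
/-- `horizontalPart` is the differential of the projection `TM → M`. -/
theorem mfderiv_proj_eq_horizontalPart (p : TangentBundle I M) :
    mfderiv I.tangent I (TotalSpace.proj : TangentBundle I M → M) p = horizontalPart p := by
  have hd : MDifferentiableAt I.tangent I (TotalSpace.proj : TangentBundle I M → M) p :=
    (contMDiffAt_proj (n := 1) (TangentSpace I)).mdifferentiableAt one_ne_zero
  have key : ∀ y ∈ (extChartAt I.tangent p).target,
      writtenInExtChartAt I.tangent I p (TotalSpace.proj : TangentBundle I M → M) y = y.1 := by
    intro y hy
    have hy' : y ∈ (extChartAt (I.prod 𝓘(ℝ, E)) p).target := hy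
    rw [FiberBundle.extChartAt_target] at hy'
    have h1 : ((extChartAt (I.prod 𝓘(ℝ, E)) p).symm y).proj
        = (extChartAt I p.proj).symm y.1 := by
      rw [FiberBundle.extChartAt]
      exact (trivializationAt E (TangentSpace I) p.proj).proj_symm_apply' hy'.1.2
    change extChartAt I p.proj ((extChartAt (I.prod 𝓘(ℝ, E)) p).symm y).proj = y.1
    rw [h1, PartialEquiv.right_inv _ hy'.1.1]
  rw [hd.mfderiv]
  have hm := mem_extChartAt_target (I := I.tangent) p
  have e : writtenInExtChartAt I.tangent I p (TotalSpace.proj : TangentBundle I M → M)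
      =ᶠ[nhdsWithin (extChartAt I.tangent p p) (range I.tangent)] Prod.fst := by
    filter_upwards [extChartAt_target_mem_nhdsWithin (I := I.tangent) p] using key
  rw [e.fderivWithin_eq (key _ hm)]
  exact fderivWithin_fst (I.tangent.uniqueDiffOn _ (extChartAt_target_subset_range p hm))

/-- The map `X^H + Y^V ↦ Y` (the connection map of `g`). -/
def verticalPart (g : BilinField I M) (p : TangentBundle I M) :
    TangentSpace I.tangent p →L[ℝ] TangentSpace I p.proj :=
  (ContinuousLinearMap.snd ℝ E E
    + (christoffelAt g p.proj).flip p.snd ∘L ContinuousLinearMap.fst ℝ E E : E × E →L[ℝ] E)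

/-- The Mus-Gradient metric `g^f` on `TM`. Its value on a pair of tangent vectors is
`g(X, X') + g(Y, Y') + Y(f) Y'(f)`, where the vectors are `X^H + Y^V` and `X'^H + Y'^V`. -/
def musGradient (g : BilinField I M) (f : M → ℝ) : BilinField I.tangent (TangentBundle I M) :=
  fun p ↦
    let b : E →L[ℝ] E →L[ℝ] ℝ := g p.proj
    let df : E →L[ℝ] ℝ := mvfderiv I f p.proj
    let P : E × E →L[ℝ] E := horizontalPart p
    let Q : E × E →L[ℝ] E := verticalPart g p
    b.bilinearComp P P + (b + df.smulRight df).bilinearComp Q Q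

/-- The decomposition `T_p TM = H_p ⊕ V_p`. -/
theorem horizontalLift_add_verticalLift (g : BilinField I M) (p : TangentBundle I M)
    (ξ : TangentSpace I.tangent p) :
    horizontalLift g p (horizontalPart p ξ) + verticalLift p (verticalPart g p ξ) = ξ := by
  change ((ξ : E × E).1, - christoffelAt g p.proj (ξ : E × E).1 p.snd)
    + ((0 : E), (ξ : E × E).2 + christoffelAt g p.proj (ξ : E × E).1 p.snd) = (ξ : E × E)
  ext <;> simp

/-- The three identities that characterize `g^f` on horizontal and vertical lifts. -/
theorem musGradient_lifts (g : BilinField I M) (f : M → ℝ) (p : TangentBundle I M)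
    (X Y : TangentSpace I p.proj) :
    musGradient g f p (horizontalLift g p X) (horizontalLift g p Y) = g p.proj X Y ∧
    musGradient g f p (horizontalLift g p X) (verticalLift p Y) = 0 ∧
    musGradient g f p (verticalLift p X) (verticalLift p Y)
      = g p.proj X Y + mvfderiv I f p.proj X * mvfderiv I f p.proj Y := by
  have h1 (Z : TangentSpace I p.proj) : horizontalPart p (horizontalLift g p Z) = Z := rfl
  have h2 (Z : TangentSpace I p.proj) : horizontalPart p (verticalLift p Z) = 0 := rfl
  have h3 (Z : TangentSpace I p.proj) : verticalPart g p (horizontalLift g p Z) = 0 :=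
    neg_add_cancel (christoffelAt g p.proj Z p.snd : E)
  have h4 (Z : TangentSpace I p.proj) : verticalPart g p (verticalLift p Z) = Z := by
    have : (christoffelAt g p.proj).flip p.snd (0 : E) = 0 := map_zero _
    exact (congrArg (fun t : E ↦ (show E from Z) + t) this).trans (add_zero _)
  have key (ξ η : TangentSpace I.tangent p) : musGradient g f p ξ η =
      g p.proj (horizontalPart p ξ) (horizontalPart p η)
      + (g p.proj (verticalPart g p ξ) (verticalPart g p η)
        + mvfderiv I f p.proj (verticalPart g p ξ) * mvfderiv I f p.proj (verticalPart g p η)) :=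
    rfl
  refine ⟨?_, ?_, ?_⟩ <;> simp [key, h1, h2, h3, h4]

end MusGradient

end

/-! In induced coordinates on `TM` the projection `π` is `Prod.fst`, and `g^f` has the form `G(ξ₁,
η₁) + K(ξ₂ + Γ(ξ₁, y), η₂ + Γ(η₁, y))` with `K = G + df ⊗ df` (`tangentMetric`). Horizontal lifts
are isometric to base vectors, so an orthonormal frame of `TM` splits into a lifted frame of `G` and
a vertical frame of `K`, and every trace over `TM` splits accordingly (`metricTrace_splitForm`).

The Koszul formula, tested against horizontal vectors, gives the base components of the Christoffel
symbols of `g^f`. On two horizontal vectors they are those of `G`. On two vertical vectors they are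
dual to `-½ ∇(df ⊗ df)`, whose `K`-trace is `-½ grad ln α`, because `K⁻¹ df = α⁻¹ grad f` and `dα =
2 Hess f(·, grad f)`. Since `π` has no second derivative, `τ(π) = ½ grad ln α` (`tension_fst`).

This field is pulled back from `M`. For such a field `W ∘ π` the same splitting yields `J(W ∘ π) =
-(Ric W + Tr ∇²W + ½ ∇_{grad ln α} W)` (`jacobi_fst`). With `l = ln α` and `W = ½ grad l`, the
identities `Tr ∇² grad l = grad Δl + Ric(grad l)` (`metricTrace_secondCovDeriv_gradient`) and `grad
‖grad l‖² = 2 ∇_{grad l} grad l` (`gradient_normSq_gradient`) turn the bitension field into minus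
the left side of the stated equation, evaluated at the base point. As `π` is onto, the equivalence
follows.

The global objects are defined at each point through the preferred chart of that point, while
derivatives need them on a neighbourhood in one fixed chart. The transformation law of the
Christoffel symbols (`christoffel_pullback`) closes this gap: it makes the Laplacian chart
independent and identifies `g^f` with `tangentMetric` throughout an induced chart
(`metricInChart_musGradient`). -/

noncomputable section

namespace LocalGeometry

/-! ### Inner products and metric traces -/

section LinearAlgebra

variable {E : Type*} [NormedAddCommGroup E] [NormedSpace ℝ E]
  {F : Type*} [NormedAddCommGroup F] [NormedSpace ℝ F]

/-- A symmetric positive definite bilinear form. -/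
structure IsInner (b : E →L[ℝ] E →L[ℝ] ℝ) : Prop where
  symm : ∀ u v, b u v = b v u
  pos : ∀ u, u ≠ 0 → 0 < b u u

namespace IsInner

variable {b : E →L[ℝ] E →L[ℝ] ℝ}

theorem eq_of_forall (hb : IsInner b) {u v : E} (h : ∀ w, b u w = b v w) : u = v := by
  by_contra hne
  have h1 := hb.pos (u - v) (sub_ne_zero.2 hne)
  simp [h] at h1

theorem isInvertible [FiniteDimensional ℝ E] (hb : IsInner b) : b.IsInvertible := by
  have hinj : Function.Injective b := fun u v h ↦ hb.eq_of_forall fun w ↦ by rw [h]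
  have hdim : Module.finrank ℝ E = Module.finrank ℝ (E →L[ℝ] ℝ) := by
    rw [← (LinearMap.toContinuousLinearMap (𝕜 := ℝ) (E := E) (F' := ℝ)).finrank_eq]
    exact (Subspace.dual_finrank_eq (K := ℝ) (V := E)).symm
  refine ⟨(LinearEquiv.ofInjectiveOfFinrankEq (b : E →ₗ[ℝ] E →L[ℝ] ℝ) hinj
    hdim).toContinuousLinearEquiv, ?_⟩
  ext u v
  rfl

theorem apply_inverse [FiniteDimensional ℝ E] (hb : IsInner b) (ξ : E →L[ℝ] ℝ) :
    b (b.inverse ξ) = ξ := hb.isInvertible.self_apply_inverse ξ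

theorem inverse_eq_iff [FiniteDimensional ℝ E] (hb : IsInner b) {ξ : E →L[ℝ] ℝ} {v : E} :
    b.inverse ξ = v ↔ ∀ w, b v w = ξ w := by
  constructor
  · rintro rfl w
    rw [hb.apply_inverse]
  · intro h
    exact hb.eq_of_forall fun w ↦ by rw [hb.apply_inverse, h]

theorem exists_orthonormal_basis [FiniteDimensional ℝ E] (hb : IsInner b) :
    ∃ e : Module.Basis (Fin (Module.finrank ℝ E)) ℝ E,
      ∀ i j, b (e i) (e j) = if i = j then 1 else 0 := by
  let B : LinearMap.BilinForm ℝ E := LinearMap.mk₂ ℝ (fun u v ↦ b u v) (by simp) (by simp)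
    (by simp) (by simp)
  have hB : ∀ u v, B u v = b u v := fun _ _ ↦ rfl
  obtain ⟨v, hv⟩ := LinearMap.BilinForm.exists_orthogonal_basis (B := B)
    ⟨fun u v ↦ by simp [hB, hb.symm u v]⟩
  have hpos : ∀ i, 0 < b (v i) (v i) := fun i ↦ hb.pos _ (v.ne_zero i)
  have hw : ∀ i, IsUnit (1 / √(b (v i) (v i))) := fun i ↦
    (one_div_ne_zero (Real.sqrt_pos.2 (hpos i)).ne').isUnit
  refine ⟨v.isUnitSMul hw, fun i j ↦ ?_⟩
  simp only [Module.Basis.isUnitSMul_apply, map_smul, smul_apply, smul_eq_mul]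
  split_ifs with h
  · subst h
    have h1 := Real.mul_self_sqrt (hpos i).le
    have h2 := (Real.sqrt_pos.2 (hpos i)).ne'
    field_simp
    nlinarith
  · have : b (v i) (v j) = 0 := hv h
    simp [this]

end IsInner

variable {b : E →L[ℝ] E →L[ℝ] ℝ}

theorem sum_orthonormal {ι : Type*} [Fintype ι] [DecidableEq ι] {e : Module.Basis ι ℝ E}
    (he : ∀ i j, b (e i) (e j) = if i = j then 1 else 0) (v : E) :
    ∑ j, b v (e j) • e j = v := by
  have h : ∀ j, b v (e j) = e.repr v j := by
    intro j
    have h1 := congrArg (fun w ↦ b w (e j)) (e.sum_repr v)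
    simp only [map_sum, map_smul, sum_apply, smul_apply, he, smul_eq_mul, mul_ite, mul_one,
      mul_zero, Finset.sum_ite_eq', Finset.mem_univ, if_true] at h1
    exact h1.symm
  simp only [h, e.sum_repr]

variable [FiniteDimensional ℝ E]

/-- `metricTrace` contracts a fixed basis with its `b`-dual basis. Expanding the dual vectors in `e`
and exchanging the two sums frees the trace from that choice, so that adapted orthonormal frames may
be used later. -/
theorem metricTrace_eq_sum (hb : IsInner b) {ι : Type*} [Fintype ι] [DecidableEq ι]
    {e : Module.Basis ι ℝ E} (he : ∀ i j, b (e i) (e j) = if i = j then 1 else 0)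
    (B : E →L[ℝ] E →L[ℝ] F) :
    metricTrace b (fun u w ↦ B u w) = ∑ j, B (e j) (e j) := by
  set f := Module.finBasis ℝ E
  have h1 : ∀ i, b.inverse (LinearMap.toContinuousLinearMap (f.coord i))
      = ∑ j, f.repr (e j) i • e j := by
    intro i
    conv_lhs => rw [← sum_orthonormal he (b.inverse (LinearMap.toContinuousLinearMap (f.coord i)))]
    simp [hb.apply_inverse]
  have h2 : ∀ j, B (e j) (e j) = ∑ i, f.repr (e j) i • B (f i) (e j) := by
    intro j
    have h1 := congrArg (fun w ↦ B w (e j)) (f.sum_repr (e j))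
    simp only [map_sum, map_smul, sum_apply, smul_apply] at h1
    exact h1.symm
  calc metricTrace b (fun u w ↦ B u w) = ∑ i, ∑ j, f.repr (e j) i • B (f i) (e j) := by
        refine Finset.sum_congr rfl fun i _ ↦ ?_
        simp only [← map_smul, ← map_sum]
        exact congrArg _ (h1 i)
    _ = _ := by
        rw [Finset.sum_comm]
        exact Finset.sum_congr rfl fun j _ ↦ (h2 j).symm

/-- The trace only sees the quadratic form of a bilinear map. -/
theorem metricTrace_congr_diag (hb : IsInner b) {B B' : E →L[ℝ] E →L[ℝ] F}
    (h : ∀ u, B u u = B' u u) :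
    metricTrace b (fun u w ↦ B u w) = metricTrace b (fun u w ↦ B' u w) := by
  obtain ⟨e, he⟩ := hb.exists_orthonormal_basis
  simp only [metricTrace_eq_sum hb he, h]

theorem metricTrace_symm_apply (hb : IsInner b) (B : E →L[ℝ] E →L[ℝ] F) :
    metricTrace b (fun u w ↦ B u w) = metricTrace b (fun u w ↦ B w u) :=
  metricTrace_congr_diag (B' := B.flip) hb fun _ ↦ rfl

omit [NormedSpace ℝ F] in
theorem metricTrace_add (B B' : E → E → F) :
    metricTrace b (fun u w ↦ B u w + B' u w) = metricTrace b B + metricTrace b B' :=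
  Finset.sum_add_distrib

omit [NormedSpace ℝ F] in
theorem metricTrace_neg (B : E → E → F) :
    metricTrace b (fun u w ↦ - B u w) = - metricTrace b B :=
  Finset.sum_neg_distrib _

theorem metricTrace_const_smul (c : ℝ) (B : E → E → F) :
    metricTrace b (fun u w ↦ c • B u w) = c • metricTrace b B :=
  Finset.smul_sum.symm

theorem metricTrace_map {F₂ : Type*} [NormedAddCommGroup F₂] [NormedSpace ℝ F₂] (T : F →L[ℝ] F₂)
    (B : E → E → F) : metricTrace b (fun u w ↦ T (B u w)) = T (metricTrace b B) :=
  (map_sum T _ _).symm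

/-- The trace is invariant under linear isometries. -/
theorem metricTrace_isometry {E₂ : Type*} [NormedAddCommGroup E₂] [NormedSpace ℝ E₂]
    [FiniteDimensional ℝ E₂] {b' : E₂ →L[ℝ] E₂ →L[ℝ] ℝ} (hb : IsInner b) (hb' : IsInner b')
    (T : E ≃L[ℝ] E₂) (hT : ∀ u v, b u v = b' (T u) (T v)) (B : E₂ →L[ℝ] E₂ →L[ℝ] F) :
    metricTrace b (fun u w ↦ B (T u) (T w)) = metricTrace b' (fun u w ↦ B u w) := by
  obtain ⟨e, he⟩ := hb.exists_orthonormal_basis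
  have he' : ∀ i j, b' (e.map T.toLinearEquiv i) (e.map T.toLinearEquiv j)
      = if i = j then 1 else 0 := by
    intro i j
    rw [← he i j, hT]
    rfl
  rw [metricTrace_eq_sum hb' he']
  exact metricTrace_eq_sum hb he (B.bilinearComp (T : E →L[ℝ] E₂) (T : E →L[ℝ] E₂))

/-- The form `b(ξ₁, η₁) + k(ξ₂ + A ξ₁, η₂ + A η₁)` on `E × E`, for which the graph of `-A` is
orthogonal to `0 × E`. -/
def splitForm (b k : E →L[ℝ] E →L[ℝ] ℝ) (A : E →L[ℝ] E) : E × E →L[ℝ] E × E →L[ℝ] ℝ :=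
  b.bilinearComp (ContinuousLinearMap.fst ℝ E E) (ContinuousLinearMap.fst ℝ E E)
    + k.bilinearComp (ContinuousLinearMap.snd ℝ E E + A ∘L ContinuousLinearMap.fst ℝ E E)
      (ContinuousLinearMap.snd ℝ E E + A ∘L ContinuousLinearMap.fst ℝ E E)

omit [FiniteDimensional ℝ E] in
theorem splitForm_apply (b k : E →L[ℝ] E →L[ℝ] ℝ) (A : E →L[ℝ] E) (ξ η : E × E) :
    splitForm b k A ξ η = b ξ.1 η.1 + k (ξ.2 + A ξ.1) (η.2 + A η.1) := rfl

omit [FiniteDimensional ℝ E] in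
theorem IsInner.splitForm {k : E →L[ℝ] E →L[ℝ] ℝ} (hb : IsInner b) (hk : IsInner k)
    (A : E →L[ℝ] E) : IsInner (splitForm b k A) := by
  refine ⟨fun ξ η ↦ ?_, fun ξ hξ ↦ ?_⟩
  · rw [splitForm_apply, splitForm_apply, hb.symm, hk.symm]
  · rw [splitForm_apply]
    have nn : ∀ {c : E →L[ℝ] E →L[ℝ] ℝ}, IsInner c → ∀ v, 0 ≤ c v v := by
      intro c hc v
      by_cases hv : v = 0
      · simp [hv]
      · exact (hc.pos v hv).le
    by_cases h1 : ξ.1 = 0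
    · have h2 : ξ.2 ≠ 0 := fun h2 ↦ hξ (Prod.ext h1 h2)
      simpa [h1] using hk.pos _ h2
    · exact add_pos_of_pos_of_nonneg (hb.pos _ h1) (nn hk _)

/-- The shear `T` carries `e ⊕ e'` to the frame of horizontal vectors `(e i, -A (e i))` and vertical
vectors `(0, e' i)`, which is orthonormal for `splitForm b k A`. -/
theorem metricTrace_splitForm {k : E →L[ℝ] E →L[ℝ] ℝ} (hb : IsInner b) (hk : IsInner k)
    (A : E →L[ℝ] E) (B : E × E →L[ℝ] E × E →L[ℝ] F) :
    metricTrace (splitForm b k A) (fun ξ η ↦ B ξ η)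
      = metricTrace b (fun u w ↦ B (u, - A u) (w, - A w))
        + metricTrace k (fun u w ↦ B (0, u) (0, w)) := by
  obtain ⟨e, he⟩ := hb.exists_orthonormal_basis
  obtain ⟨e', he'⟩ := hk.exists_orthonormal_basis
  let T : (E × E) ≃ₗ[ℝ] (E × E) :=
    { toFun := fun p ↦ (p.1, p.2 - A p.1)
      invFun := fun p ↦ (p.1, p.2 + A p.1)
      map_add' := fun p q ↦ by ext <;> simp; abel
      map_smul' := fun c p ↦ by ext <;> simp [smul_sub]
      left_inv := fun p ↦ by simp
      right_inv := fun p ↦ by simp }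
  have hl : ∀ i, ((e.prod e').map T) (Sum.inl i) = (e i, - A (e i)) := fun i ↦ by
    simp [T]
  have hr : ∀ i, ((e.prod e').map T) (Sum.inr i) = (0, e' i) := fun i ↦ by
    simp [T]
  have hT : ∀ i j, splitForm b k A (((e.prod e').map T) i) (((e.prod e').map T) j)
      = if i = j then 1 else 0 := by
    rintro (i | i) (j | j) <;> simp only [hl, hr, splitForm_apply] <;> simp [he, he']
  rw [metricTrace_eq_sum (hb.splitForm hk A) hT]
  simp only [Fintype.sum_sum_type, hl, hr]
  congr 1
  · exact (metricTrace_eq_sum hb he (B.bilinearComp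
      ((ContinuousLinearMap.id ℝ E).prod (-A)) ((ContinuousLinearMap.id ℝ E).prod (-A)))).symm
  · exact (metricTrace_eq_sum hk he' (B.bilinearComp
      (ContinuousLinearMap.inr ℝ E E) (ContinuousLinearMap.inr ℝ E E))).symm

end LinearAlgebra

end LocalGeometry

namespace LocalGeometry

/-! ### Product rules and symmetry of second derivatives -/

section Calculus

variable {E : Type*} [NormedAddCommGroup E] [NormedSpace ℝ E]
  {E₁ : Type*} [NormedAddCommGroup E₁] [NormedSpace ℝ E₁]
  {E₂ : Type*} [NormedAddCommGroup E₂] [NormedSpace ℝ E₂]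
  {F : Type*} [NormedAddCommGroup F] [NormedSpace ℝ F]

theorem fderiv_apply₁ {A : E → E₁ →L[ℝ] F} {a : E → E₁} {x : E} (hA : DifferentiableAt ℝ A x)
    (ha : DifferentiableAt ℝ a x) (z : E) :
    fderiv ℝ (fun y ↦ A y (a y)) x z = fderiv ℝ A x z (a x) + A x (fderiv ℝ a x z) := by
  rw [fderiv_clm_apply hA ha, add_comm]
  rfl

theorem fderiv_apply₂ {B : E → E₁ →L[ℝ] E₂ →L[ℝ] F} {a : E → E₁} {c : E → E₂} {x : E}
    (hB : DifferentiableAt ℝ B x) (ha : DifferentiableAt ℝ a x) (hc : DifferentiableAt ℝ c x)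
    (z : E) :
    fderiv ℝ (fun y ↦ B y (a y) (c y)) x z = fderiv ℝ B x z (a x) (c x)
      + B x (fderiv ℝ a x z) (c x) + B x (a x) (fderiv ℝ c x z) := by
  rw [fderiv_apply₁ (hB.clm_apply ha) hc, fderiv_apply₁ hB ha]
  rfl

theorem fderiv_apply_const {A : E → E₁ →L[ℝ] F} {x : E} (hA : DifferentiableAt ℝ A x) (v : E₁)
    (z : E) : fderiv ℝ (fun y ↦ A y v) x z = fderiv ℝ A x z v := by
  rw [fderiv_apply₁ hA (differentiableAt_const v)]
  simp

theorem fderiv_apply_const₂ {B : E → E₁ →L[ℝ] E₂ →L[ℝ] F} {x : E} (hB : DifferentiableAt ℝ B x)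
    (v : E₁) (w : E₂) (z : E) : fderiv ℝ (fun y ↦ B y v w) x z = fderiv ℝ B x z v w := by
  rw [fderiv_apply₂ hB (differentiableAt_const v) (differentiableAt_const w)]
  simp

theorem fderiv_eq_of_eqOn {f g : E → F} {U : Set E} (hU : IsOpen U) (h : Set.EqOn f g U) {x : E}
    (hx : x ∈ U) : fderiv ℝ f x = fderiv ℝ g x :=
  (h.eventuallyEq_of_mem (hU.mem_nhds hx)).fderiv_eq

theorem fderiv_fderiv_symm {f : E → F} {U : Set E} (hU : IsOpen U) (hf : ContDiffOn ℝ ∞ f U)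
    {x : E} (hx : x ∈ U) (u v : E) :
    fderiv ℝ (fderiv ℝ f) x u v = fderiv ℝ (fderiv ℝ f) x v u :=
  ((hf.contDiffAt (hU.mem_nhds hx)).isSymmSndFDerivAt (by
    simp only [minSmoothness_of_isRCLikeNormedField]
    exact WithTop.coe_le_coe.2 le_top)).eq u v

theorem contDiffOn_fderiv {f : E → F} {U : Set E} (hU : IsOpen U) (hf : ContDiffOn ℝ ∞ f U) :
    ContDiffOn ℝ ∞ (fderiv ℝ f) U :=
  hf.fderiv_of_isOpen hU (by simp)

theorem differentiableAt_of_contDiffOn {f : E → F} {U : Set E} (hU : IsOpen U)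
    (hf : ContDiffOn ℝ ∞ f U) {x : E} (hx : x ∈ U) : DifferentiableAt ℝ f x :=
  (hf.contDiffAt (hU.mem_nhds hx)).differentiableAt (by simp)

end Calculus

/-! ### Levi-Civita connection and curvature in coordinates -/

variable {E : Type*} [NormedAddCommGroup E] [NormedSpace ℝ E]

/-- `G` is a Riemannian metric on the open set `U`. -/
structure IsMetricOn (G : E → E →L[ℝ] E →L[ℝ] ℝ) (U : Set E) : Prop where
  isOpen : IsOpen U
  contDiffOn : ContDiffOn ℝ ∞ G U
  isInner : ∀ y ∈ U, IsInner (G y)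

/-- The gradient `G⁻¹ dk`. -/
def coordGrad (G : E → E →L[ℝ] E →L[ℝ] ℝ) (k : E → ℝ) (y : E) : E := (G y).inverse (fderiv ℝ k y)

/-- The covariant derivative `u ↦ ∇_u W` of a vector field. -/
def covDeriv (G : E → E →L[ℝ] E →L[ℝ] ℝ) (W : E → E) (y : E) : E →L[ℝ] E :=
  fderiv ℝ W y + (christoffel G y).flip (W y)

/-- The Hessian `∇dk`. -/
def hessian (G : E → E →L[ℝ] E →L[ℝ] ℝ) (k : E → ℝ) (y : E) : E →L[ℝ] E →L[ℝ] ℝ :=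
  fderiv ℝ (fderiv ℝ k) y
    - (ContinuousLinearMap.compL ℝ E E ℝ (fderiv ℝ k y)) ∘L christoffel G y

/-- The second covariant derivative `∇²_{u, w} W`. -/
def secondCovDeriv (G : E → E →L[ℝ] E →L[ℝ] ℝ) (W : E → E) (y : E) : E →L[ℝ] E →L[ℝ] E :=
  fderiv ℝ (covDeriv G W) y
    + (ContinuousLinearMap.compL ℝ E E E).flip (covDeriv G W y) ∘L christoffel G y
    - (ContinuousLinearMap.compL ℝ E E E (covDeriv G W y)) ∘L christoffel G y

/-- The curvature `R(u, v) w` as a bilinear map of `v` and `w`. -/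
def curvatureForm (G : E → E →L[ℝ] E →L[ℝ] ℝ) (y u : E) : E →L[ℝ] E →L[ℝ] E :=
  fderiv ℝ (christoffel G) y u - (fderiv ℝ (christoffel G) y).flip u
    + (ContinuousLinearMap.compL ℝ E E E (christoffel G y u)) ∘L christoffel G y
    - (ContinuousLinearMap.compL ℝ E E E).flip (christoffel G y u) ∘L christoffel G y

theorem covDeriv_apply (G : E → E →L[ℝ] E →L[ℝ] ℝ) (W : E → E) (y u : E) :
    covDeriv G W y u = fderiv ℝ W y u + christoffel G y u (W y) := rfl

theorem hessian_apply (G : E → E →L[ℝ] E →L[ℝ] ℝ) (k : E → ℝ) (y u w : E) :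
    hessian G k y u w = fderiv ℝ (fderiv ℝ k) y u w - fderiv ℝ k y (christoffel G y u w) := rfl

theorem secondCovDeriv_apply (G : E → E →L[ℝ] E →L[ℝ] ℝ) (W : E → E) (y u w : E) :
    secondCovDeriv G W y u w = fderiv ℝ (covDeriv G W) y u w
      + christoffel G y u (covDeriv G W y w) - covDeriv G W y (christoffel G y u w) := rfl

namespace IsMetricOn

variable [FiniteDimensional ℝ E] {G : E → E →L[ℝ] E →L[ℝ] ℝ} {U : Set E} (hG : IsMetricOn G U)
  {x : E} (hx : x ∈ U)

include hG

omit [FiniteDimensional ℝ E] in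
theorem differentiableAt (hx : x ∈ U) : DifferentiableAt ℝ G x :=
  differentiableAt_of_contDiffOn hG.isOpen hG.contDiffOn hx

theorem contDiffOn_inverse : ContDiffOn ℝ ∞ (fun y ↦ (G y).inverse) U := by
  have : CompleteSpace E := FiniteDimensional.complete ℝ E
  intro y hy
  exact ((hG.isInner y hy).isInvertible.contDiffAt_map_inverse).comp_contDiffWithinAt y
    (hG.contDiffOn y hy)

theorem contDiffOn_christoffel : ContDiffOn ℝ ∞ (christoffel G) U := by
  have hD := contDiffOn_fderiv hG.isOpen hG.contDiffOn
  have hflip : ContDiffOn ℝ ∞ (fun y ↦ (fderiv ℝ G y).flip) U :=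
    (ContinuousLinearMap.flipₗᵢ ℝ E E (E →L[ℝ] ℝ)).contDiff.comp_contDiffOn hD
  exact ContDiffOn.clm_comp
    ((ContinuousLinearMap.compL ℝ E (E →L[ℝ] ℝ) E).contDiff.comp_contDiffOn hG.contDiffOn_inverse)
    (((hD.add hflip).sub (contDiffOn_const.clm_comp hflip)).const_smul (1 / 2 : ℝ))

theorem differentiableAt_christoffel (hx : x ∈ U) : DifferentiableAt ℝ (christoffel G) x :=
  differentiableAt_of_contDiffOn hG.isOpen hG.contDiffOn_christoffel hx

include hx

omit [FiniteDimensional ℝ E] in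
theorem fderiv_symm (z u v : E) : fderiv ℝ G x z u v = fderiv ℝ G x z v u := by
  rw [← fderiv_apply_const₂ (hG.differentiableAt hx), ← fderiv_apply_const₂ (hG.differentiableAt hx)]
  rw [fderiv_eq_of_eqOn hG.isOpen (fun y hy ↦ (hG.isInner y hy).symm u v) hx]

theorem two_mul_christoffel (u v w : E) : 2 * G x (christoffel G x u v) w
    = fderiv ℝ G x u v w + fderiv ℝ G x v u w - fderiv ℝ G x w u v :=
  two_mul_metric_christoffel (hG.isInner x hx).isInvertible u v w

theorem christoffel_symm (u v : E) : christoffel G x u v = christoffel G x v u := by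
  refine (hG.isInner x hx).eq_of_forall fun w ↦ ?_
  have h1 := hG.two_mul_christoffel hx u v w
  have h2 := hG.two_mul_christoffel hx v u w
  have h3 := hG.fderiv_symm hx w u v
  linarith

/-- Metric compatibility of the Levi-Civita connection. -/
theorem fderiv_metric (u v w : E) : fderiv ℝ G x u v w
    = G x (christoffel G x u v) w + G x v (christoffel G x u w) := by
  have h1 := hG.two_mul_christoffel hx u v w
  have h2 := hG.two_mul_christoffel hx u w v
  have h3 := (hG.isInner x hx).symm v (christoffel G x u w)
  have h4 := hG.fderiv_symm hx v u w
  have h5 := hG.fderiv_symm hx u v w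
  have h6 := hG.fderiv_symm hx w u v
  linarith

theorem fderiv_christoffel_symm (z u v : E) :
    fderiv ℝ (christoffel G) x z u v = fderiv ℝ (christoffel G) x z v u := by
  have h := hG.differentiableAt_christoffel hx
  rw [← fderiv_apply_const₂ h, ← fderiv_apply_const₂ h]
  rw [fderiv_eq_of_eqOn hG.isOpen (fun y hy ↦ hG.christoffel_symm hy u v) hx]

omit hG hx [FiniteDimensional ℝ E] in
theorem curvature_antisymm (u v w : E) : curvature G x u v w = - curvature G x v u w := by
  simp only [curvature]
  abel

/-- Only the symmetry of `Γ`, and hence of its derivative, in the two lower slots is needed. -/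
theorem bianchi (u v w : E) :
    curvature G x u v w + curvature G x v w u + curvature G x w u v = 0 := by
  simp only [curvature, hG.fderiv_christoffel_symm hx u w v, hG.fderiv_christoffel_symm hx v u w,
    hG.fderiv_christoffel_symm hx w v u, hG.christoffel_symm hx w v, hG.christoffel_symm hx u w,
    hG.christoffel_symm hx v u]
  abel

theorem fderiv_fderiv_metric (z u v w : E) : fderiv ℝ (fderiv ℝ G) x z u v w
    = fderiv ℝ G x z (christoffel G x u v) w + G x (fderiv ℝ (christoffel G) x z u v) w
      + fderiv ℝ G x z v (christoffel G x u w) + G x v (fderiv ℝ (christoffel G) x z u w) := by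
  have hΓ := hG.differentiableAt_christoffel hx
  have hg := hG.differentiableAt hx
  have hD : DifferentiableAt ℝ (fderiv ℝ G) x :=
    differentiableAt_of_contDiffOn hG.isOpen (contDiffOn_fderiv hG.isOpen hG.contDiffOn) hx
  have hΓ' : ∀ a, DifferentiableAt ℝ (fun y ↦ christoffel G y u a) x := fun a ↦
    (hΓ.clm_apply (differentiableAt_const u)).clm_apply (differentiableAt_const a)
  have h1 : fderiv ℝ (fun y ↦ fderiv ℝ G y u v w) x z = fderiv ℝ (fderiv ℝ G) x z u v w := by
    rw [fderiv_apply_const₂ (hD.clm_apply (differentiableAt_const u)), fderiv_apply_const hD]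
  have hc := differentiableAt_const (𝕜 := ℝ) (x := x) (E := E) (F := E)
  rw [← h1, fderiv_eq_of_eqOn hG.isOpen (fun y hy ↦ hG.fderiv_metric hy u v w) hx,
    fderiv_fun_add ((hg.clm_apply (hΓ' v)).clm_apply (hc w))
      ((hg.clm_apply (hc v)).clm_apply (hΓ' w)), add_apply,
    fderiv_apply₂ hg (hΓ' v) (hc w), fderiv_apply₂ hg (hc v) (hΓ' w),
    fderiv_apply_const₂ hΓ, fderiv_apply_const₂ hΓ]
  simp
  ring

/-- Second derivatives of `G` commute in `u` and `v`. Expressing both through metric compatibility,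
the products of two Christoffel terms with one in each slot cancel, and what remains is the
skewness. -/
theorem curvature_skew (u v w z : E) :
    G x (curvature G x u v w) z = - G x (curvature G x u v z) w := by
  have h1 := hG.fderiv_fderiv_metric hx u v w z
  have h2 := hG.fderiv_fderiv_metric hx v u w z
  have h3 := fderiv_fderiv_symm hG.isOpen hG.contDiffOn hx u v
  rw [h3] at h1
  have hs := (hG.isInner x hx).symm
  simp only [hG.fderiv_metric hx] at h1 h2
  simp only [curvature, map_add, map_sub, add_apply, sub_apply]
  rw [hs (fderiv ℝ (christoffel G) x u v z) w, hs (fderiv ℝ (christoffel G) x v u z) w,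
    hs (christoffel G x u (christoffel G x v z)) w, hs (christoffel G x v (christoffel G x u z)) w]
  linarith

/-- A formal consequence of the antisymmetries in the first and in the last pair together with the
Bianchi identity, taken at the four cyclic shifts of `(u, v, w, z)`. -/
theorem curvature_pair (u v w z : E) :
    G x (curvature G x u v w) z = G x (curvature G x w z u) v := by
  have b : ∀ a b c d, G x (curvature G x a b c) d + G x (curvature G x b c a) d
      + G x (curvature G x c a b) d = 0 := by
    intro a b c d
    have := congrArg (fun t ↦ G x t d) (hG.bianchi hx a b c)
    simpa using this
  have s := hG.curvature_skew hx
  have a : ∀ a b c d, G x (curvature G x a b c) d = - G x (curvature G x b a c) d := by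
    intro a b c d
    rw [curvature_antisymm]
    simp
  linarith [b u v w z, b v w z u, b w z u v, b z u v w, s u v w z, s v w u z, s w u v z, s v w z u,
    s w z v u, s z v w u, s w z u v, s z u w v, s u w z v, s z u v w, s u v z w, s v z u w,
    a u v w z, a v w u z, a w u v z, a v w z u, a w z v u, a z v w u, a w z u v, a z u w v, a u w z v,
    a z u v w, a u v z w, a v z u w]

end IsMetricOn

end LocalGeometry

/-! ### Hessians, the Ricci identity and the Weitzenböck formula -/

namespace LocalGeometry

namespace IsMetricOn

variable {E : Type*} [NormedAddCommGroup E] [NormedSpace ℝ E] [FiniteDimensional ℝ E]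
  {G : E → E →L[ℝ] E →L[ℝ] ℝ} {U : Set E} (hG : IsMetricOn G U)
  {k : E → ℝ} (hk : ContDiffOn ℝ ∞ k U) {W : E → E} (hW : ContDiffOn ℝ ∞ W U) {x : E} (hx : x ∈ U)

include hG

include hk in
theorem contDiffOn_gradient : ContDiffOn ℝ ∞ (coordGrad G k) U :=
  hG.contDiffOn_inverse.clm_apply (contDiffOn_fderiv hG.isOpen hk)

include hW in
theorem contDiffOn_covDeriv : ContDiffOn ℝ ∞ (covDeriv G W) U :=
  (contDiffOn_fderiv hG.isOpen hW).add
    (((ContinuousLinearMap.flipₗᵢ ℝ E E E).contDiff.comp_contDiffOn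
      hG.contDiffOn_christoffel).clm_apply hW)

include hk in
theorem contDiffOn_hessian : ContDiffOn ℝ ∞ (hessian G k) U :=
  (contDiffOn_fderiv hG.isOpen (contDiffOn_fderiv hG.isOpen hk)).sub
    (((ContinuousLinearMap.compL ℝ E E ℝ).contDiff.comp_contDiffOn
      (contDiffOn_fderiv hG.isOpen hk)).clm_comp hG.contDiffOn_christoffel)

include hx

theorem metric_gradient (k : E → ℝ) (w : E) : G x (coordGrad G k x) w = fderiv ℝ k x w := by
  rw [coordGrad, (hG.isInner x hx).apply_inverse]

include hk in
theorem hessian_symm (u w : E) : hessian G k x u w = hessian G k x w u := by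
  rw [hessian_apply, hessian_apply, fderiv_fderiv_symm hG.isOpen hk hx, hG.christoffel_symm hx]

include hk in
-- Differentiate `G(grad k, w) = dk(w)` for constant `w`; metric compatibility converts the
-- derivative of `G` into Christoffel terms.
theorem metric_covDeriv_gradient (u w : E) :
    G x (covDeriv G (coordGrad G k) x u) w = hessian G k x u w := by
  have hk' := differentiableAt_of_contDiffOn hG.isOpen (contDiffOn_fderiv hG.isOpen hk) hx
  have hg := differentiableAt_of_contDiffOn hG.isOpen (hG.contDiffOn_gradient hk) hx
  have h1 := fderiv_apply₂ (hG.differentiableAt hx) hg (differentiableAt_const w) u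
  rw [fderiv_eq_of_eqOn hG.isOpen (fun y hy ↦ hG.metric_gradient hy k w) hx,
    fderiv_apply_const hk'] at h1
  simp only [hG.fderiv_metric hx, hG.metric_gradient hx, fderiv_fun_const, Pi.zero_apply,
    zero_apply, map_zero, add_zero] at h1
  rw [hessian_apply, covDeriv_apply, map_add, add_apply, h1]
  ring

include hk in
-- The same argument one order higher. The right side is the covariant derivative of the Hessian,
-- less its correction in the slot `w`, except that the index slot `w` is corrected by `Γ(u, w)` as
-- part of the second derivative: it is `(∇_u Hess k)(w, z)`.
theorem metric_secondCovDeriv_gradient (u w z : E) :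
    G x (secondCovDeriv G (coordGrad G k) x u w) z = fderiv ℝ (hessian G k) x u w z
      - hessian G k x w (christoffel G x u z) - hessian G k x (christoffel G x u w) z := by
  have hH := differentiableAt_of_contDiffOn hG.isOpen (hG.contDiffOn_hessian hk) hx
  have hC := differentiableAt_of_contDiffOn hG.isOpen
    (hG.contDiffOn_covDeriv (hG.contDiffOn_gradient hk)) hx
  have h1 := fderiv_apply₂ (hG.differentiableAt hx) (hC.clm_apply (differentiableAt_const w))
    (differentiableAt_const z) u
  rw [fderiv_eq_of_eqOn hG.isOpen (fun y hy ↦ hG.metric_covDeriv_gradient hk hy w z) hx,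
    fderiv_apply_const₂ hH, fderiv_apply_const hC] at h1
  simp only [hG.fderiv_metric hx, hG.metric_covDeriv_gradient hk hx, fderiv_fun_const,
    Pi.zero_apply, zero_apply, map_zero, add_zero] at h1
  rw [secondCovDeriv_apply, map_sub, map_add, sub_apply, add_apply, h1,
    hG.metric_covDeriv_gradient hk hx]
  ring

include hW in
theorem fderiv_covDeriv (u w : E) : fderiv ℝ (covDeriv G W) x u w
    = fderiv ℝ (fderiv ℝ W) x u w + fderiv ℝ (christoffel G) x u w (W x)
      + christoffel G x w (fderiv ℝ W x u) := by
  have hC := differentiableAt_of_contDiffOn hG.isOpen (hG.contDiffOn_covDeriv hW) hx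
  have hW' := differentiableAt_of_contDiffOn hG.isOpen (contDiffOn_fderiv hG.isOpen hW) hx
  have hW₀ := differentiableAt_of_contDiffOn hG.isOpen hW hx
  have hΓ := hG.differentiableAt_christoffel hx
  have hw := differentiableAt_const (𝕜 := ℝ) (x := x) (E := E) w
  rw [← fderiv_apply_const hC]
  simp only [covDeriv_apply]
  rw [fderiv_fun_add (hW'.clm_apply hw) ((hΓ.clm_apply hw).clm_apply hW₀), add_apply,
    fderiv_apply_const hW', fderiv_apply₂ hΓ hw hW₀]
  simp
  abel

include hW in
/-- The Ricci identity. -/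
theorem secondCovDeriv_sub (u w : E) :
    secondCovDeriv G W x u w - secondCovDeriv G W x w u = curvature G x u w (W x) := by
  simp only [secondCovDeriv_apply, hG.fderiv_covDeriv hW hx, curvature, covDeriv_apply, map_add]
  rw [fderiv_fderiv_symm hG.isOpen hW hx, hG.christoffel_symm hx u w]
  abel

/-- The trace commutes with the covariant derivative. -/
theorem fderiv_metricTrace {T : E → E →L[ℝ] E →L[ℝ] ℝ} (hT : DifferentiableAt ℝ T x) (z : E) :
    fderiv ℝ (fun y ↦ metricTrace (G y) (fun u w ↦ T y u w)) x z
      = metricTrace (G x) (fun u w ↦ fderiv ℝ T x z u w - T x (christoffel G x z u) w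
        - T x u (christoffel G x z w)) := by
  have hb := hG.isInner x hx
  set e := Module.finBasis ℝ E
  -- The dual basis varies with the point, so its derivative enters; `hs'` finds it by
  -- differentiating `G (s i) = e.coord i`, whose right side is constant.
  let s : Fin (Module.finrank ℝ E) → E → E := fun i y ↦
    (G y).inverse (LinearMap.toContinuousLinearMap (e.coord i))
  have hs : ∀ i, DifferentiableAt ℝ (s i) x := fun i ↦
    (differentiableAt_of_contDiffOn hG.isOpen hG.contDiffOn_inverse hx).clm_apply
      (differentiableAt_const _)
  have hs' : ∀ i, fderiv ℝ (s i) x z = - (G x).inverse (fderiv ℝ G x z (s i x)) := by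
    intro i
    have h0 : fderiv ℝ (fun y ↦ G y (s i y)) x z = 0 := by
      rw [fderiv_eq_of_eqOn (g := fun _ ↦ LinearMap.toContinuousLinearMap (e.coord i)) hG.isOpen
        (fun y hy ↦ (hG.isInner y hy).apply_inverse _) hx]
      simp
    rw [fderiv_apply₁ (hG.differentiableAt hx) (hs i)] at h0
    refine hb.eq_of_forall fun w ↦ ?_
    rw [map_neg, neg_apply, hb.apply_inverse]
    have h1 := congrArg (fun t ↦ t w) h0
    simp only [add_apply, zero_apply] at h1
    linarith
  have hL : fderiv ℝ (fun y ↦ metricTrace (G y) (fun u w ↦ T y u w)) x z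
      = metricTrace (G x) (fun u w ↦ fderiv ℝ T x z u w
        - T x u ((G x).inverse (fderiv ℝ G x z w))) := by
    have hc := differentiableAt_const (𝕜 := ℝ) (x := x) (E := E) (F := E)
    have h1 : fderiv ℝ (fun y ↦ metricTrace (G y) (fun u w ↦ T y u w)) x z
        = ∑ i, fderiv ℝ (fun y ↦ T y (e i) (s i y)) x z := by
      simp only [metricTrace]
      rw [fderiv_fun_sum (fun i _ ↦ (hT.clm_apply (hc (e i))).clm_apply (hs i)),
        sum_apply]
    rw [h1]
    refine Finset.sum_congr rfl fun i _ ↦ ?_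
    rw [fderiv_apply₂ hT (hc _) (hs i), hs']
    simp [s, e, sub_eq_add_neg]
  rw [hL]
  obtain ⟨f, hf⟩ := hb.exists_orthonormal_basis
  set A := christoffel G x z
  -- Metric compatibility says that `G⁻¹ ∂_z G` is `A` plus its `G`-adjoint; the sum over `i` is the
  -- adjoint applied to `f j`.
  have hA : ∀ j, (G x).inverse (fderiv ℝ G x z (f j))
      = A (f j) + ∑ i, G x (A (f i)) (f j) • f i := by
    intro j
    rw [hb.inverse_eq_iff]
    intro w
    rw [hG.fderiv_metric hx, hb.symm (f j)]
    have h1 := congrArg (fun t ↦ G x (A t) (f j)) (sum_orthonormal hf w)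
    simp only [map_sum, map_smul, sum_apply, smul_apply, smul_eq_mul] at h1
    simp only [map_add, map_sum, map_smul, sum_apply, smul_apply, add_apply, smul_eq_mul]
    rw [← h1]
    simp only [hb.symm w, mul_comm]
    rfl
  -- Under the trace, the adjoint of `A` in the second slot of `T` becomes `A` in the first slot.
  have hsum : ∑ j, T x (f j) (∑ i, G x (A (f i)) (f j) • f i) = ∑ i, T x (A (f i)) (f i) := by
    have h1 : ∀ i, T x (A (f i)) (f i) = ∑ j, G x (A (f i)) (f j) * T x (f j) (f i) := by
      intro i
      have h1 := congrArg (fun t ↦ T x t (f i)) (sum_orthonormal hf (A (f i)))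
      simp only [map_sum, map_smul, sum_apply, smul_apply, smul_eq_mul] at h1
      exact h1.symm
    simp only [h1, map_sum, map_smul, smul_eq_mul]
    exact Finset.sum_comm
  have e1 := metricTrace_eq_sum hb hf (fderiv ℝ T x z - (ContinuousLinearMap.compL ℝ E E ℝ).flip
    ((G x).inverse ∘L fderiv ℝ G x z) ∘L T x)
  have e2 := metricTrace_eq_sum hb hf (fderiv ℝ T x z - T x ∘L A
    - (ContinuousLinearMap.compL ℝ E E ℝ).flip A ∘L T x)
  refine e1.trans (Eq.trans ?_ e2.symm)
  simp [hA, Finset.sum_add_distrib, Finset.sum_sub_distrib, ← hsum, -map_sum]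
  ring

include hk in
-- The Laplacian is the trace of the Hessian, the trace commutes with `∇_z`, and `∇_z Hess k` is
-- dual to `∇²_{z, ·} grad k`.
theorem fderiv_laplacian (z : E) : fderiv ℝ (laplacian G k) x z
    = metricTrace (G x) (fun u w ↦ G x (secondCovDeriv G (coordGrad G k) x z u) w) := by
  have hH := differentiableAt_of_contDiffOn hG.isOpen (hG.contDiffOn_hessian hk) hx
  refine (hG.fderiv_metricTrace hx hH z).trans ?_
  simp only [hG.metric_secondCovDeriv_gradient hk hx]
  congr 1
  ext u w
  ring

include hk in
/-- The Weitzenböck formula for gradients. -/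
theorem metricTrace_secondCovDeriv_gradient :
    metricTrace (G x) (fun u w ↦ secondCovDeriv G (coordGrad G k) x u w)
      = coordGrad G (laplacian G k) x + ricci G x (coordGrad G k x) := by
  have hb := hG.isInner x hx
  set W := coordGrad G k with hW_def
  have hW := hG.contDiffOn_gradient hk
  refine hb.eq_of_forall fun z ↦ ?_
  -- Symmetry of the Hessian moves `z` from the test slot into the second derivative (`h1`), the
  -- Ricci identity commutes `u` and `z` (`h2`), and pair symmetry puts the curvature into the form
  -- of the Ricci trace. Equality on the diagonal is enough under the trace.
  have key : ∀ u, G x (secondCovDeriv G W x u u) z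
      = G x (secondCovDeriv G W x z u) u + G x (curvature G x (W x) u u) z := by
    intro u
    have h1 : G x (secondCovDeriv G W x u u) z = G x (secondCovDeriv G W x u z) u := by
      have hH := differentiableAt_of_contDiffOn hG.isOpen (hG.contDiffOn_hessian hk) hx
      have hs : fderiv ℝ (hessian G k) x u u z = fderiv ℝ (hessian G k) x u z u := by
        rw [← fderiv_apply_const₂ hH, ← fderiv_apply_const₂ hH,
          fderiv_eq_of_eqOn hG.isOpen (fun y hy ↦ hG.hessian_symm hk hy u z) hx]
      rw [hG.metric_secondCovDeriv_gradient hk hx, hG.metric_secondCovDeriv_gradient hk hx, hs,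
        hG.hessian_symm hk hx _ z, hG.hessian_symm hk hx u]
      ring
    have h2 := congrArg (fun t ↦ G x t u) (hG.secondCovDeriv_sub hW hx u z)
    simp only [map_sub, sub_apply] at h2
    rw [← hW_def, hG.curvature_pair hx] at h2
    rw [h1]
    linarith
  rw [map_add, add_apply, hG.metric_gradient hx, hG.fderiv_laplacian hk hx]
  have hz := fun B : E → E → E ↦ metricTrace_map (b := G x) ((G x).flip z) B
  simp only [ContinuousLinearMap.flip_apply] at hz
  rw [ricci, ← hz, ← hz, ← metricTrace_add]
  exact metricTrace_congr_diag hb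
    (B := (ContinuousLinearMap.compL ℝ E E ℝ ((G x).flip z)) ∘L secondCovDeriv G W x)
    (B' := G x ∘L (secondCovDeriv G W x z)
      + (ContinuousLinearMap.compL ℝ E E ℝ ((G x).flip z)) ∘L curvatureForm G x (W x)) key

include hk in
-- With `W = grad k`, metric compatibility gives `d‖W‖²(z) = 2 G(∇_z W, W) = 2 Hess k(z, W)`, and
-- the symmetry of the Hessian rewrites this as `2 G(∇_W W, z)`.
theorem gradient_normSq_gradient :
    coordGrad G (fun y ↦ G y (coordGrad G k y) (coordGrad G k y)) x
      = (2 : ℝ) • covDeriv G (coordGrad G k) x (coordGrad G k x) := by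
  have hb := hG.isInner x hx
  have hW := differentiableAt_of_contDiffOn hG.isOpen (hG.contDiffOn_gradient hk) hx
  refine hb.eq_of_forall fun z ↦ ?_
  rw [hG.metric_gradient hx, fderiv_apply₂ (hG.differentiableAt hx) hW hW, hG.fderiv_metric hx]
  have h1 := hG.metric_covDeriv_gradient hk hx z (coordGrad G k x)
  have h2 := hG.metric_covDeriv_gradient hk hx (coordGrad G k x) z
  rw [hG.hessian_symm hk hx] at h1
  rw [covDeriv_apply, map_add, add_apply] at h1
  rw [map_smul, smul_apply, h2, ← h1, hb.symm (coordGrad G k x), hb.symm (coordGrad G k x),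
    smul_eq_mul]
  ring

end IsMetricOn

end LocalGeometry

/-! ### The Mus-Gradient metric in coordinates and its Christoffel symbols -/

namespace LocalGeometry

variable {E : Type*} [NormedAddCommGroup E] [NormedSpace ℝ E]

/-- The form `G + dk ⊗ dk`. -/
def gradMetric (G : E → E →L[ℝ] E →L[ℝ] ℝ) (k : E → ℝ) (y : E) : E →L[ℝ] E →L[ℝ] ℝ :=
  G y + (fderiv ℝ k y).smulRight (fderiv ℝ k y)

/-- The Mus-Gradient metric of `G` and `k` in the coordinates of `E × E`. -/
def tangentMetric (G : E → E →L[ℝ] E →L[ℝ] ℝ) (k : E → ℝ) (p : E × E) :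
    E × E →L[ℝ] E × E →L[ℝ] ℝ :=
  splitForm (G p.1) (gradMetric G k p.1) ((christoffel G p.1).flip p.2)

theorem gradMetric_apply (G : E → E →L[ℝ] E →L[ℝ] ℝ) (k : E → ℝ) (y u w : E) :
    gradMetric G k y u w = G y u w + fderiv ℝ k y u * fderiv ℝ k y w := rfl

theorem tangentMetric_apply (G : E → E →L[ℝ] E →L[ℝ] ℝ) (k : E → ℝ) (p ξ η : E × E) :
    tangentMetric G k p ξ η = G p.1 ξ.1 η.1 + gradMetric G k p.1
      (ξ.2 + christoffel G p.1 ξ.1 p.2) (η.2 + christoffel G p.1 η.1 p.2) := rfl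

/-- The function `1 + ‖grad k‖²`. -/
def gradDensity (G : E → E →L[ℝ] E →L[ℝ] ℝ) (k : E → ℝ) (y : E) : ℝ :=
  1 + G y (coordGrad G k y) (coordGrad G k y)

theorem IsInner.gradMetric {G : E → E →L[ℝ] E →L[ℝ] ℝ} {y : E} (hb : IsInner (G y)) (k : E → ℝ) :
    IsInner (gradMetric G k y) where
  symm u v := by rw [gradMetric_apply, gradMetric_apply, hb.symm, mul_comm]
  pos u hu := by
    rw [gradMetric_apply]
    exact add_pos_of_pos_of_nonneg (hb.pos u hu) (mul_self_nonneg _)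

theorem metricTrace_mul [FiniteDimensional ℝ E] {b : E →L[ℝ] E →L[ℝ] ℝ} (hb : IsInner b)
    (φ ψ : E →L[ℝ] ℝ) : metricTrace b (fun u w ↦ φ u * ψ w) = φ (b.inverse ψ) := by
  obtain ⟨e, he⟩ := hb.exists_orthonormal_basis
  refine (metricTrace_eq_sum hb he (φ.smulRight ψ)).trans ?_
  have h1 := congrArg φ (sum_orthonormal he (b.inverse ψ))
  simp only [map_sum, map_smul, hb.apply_inverse, smul_eq_mul] at h1
  rw [← h1]
  exact Finset.sum_congr rfl fun i _ ↦ mul_comm _ _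

theorem fderiv_comp_fst {F : Type*} [NormedAddCommGroup F] [NormedSpace ℝ F] {f : E → F}
    {p : E × E} (hf : DifferentiableAt ℝ f p.1) (ζ : E × E) :
    fderiv ℝ (fun q : E × E ↦ f q.1) p ζ = fderiv ℝ f p.1 ζ.1 := by
  have h := (hf.hasFDerivAt.comp p (hasFDerivAt_fst (𝕜 := ℝ) (p := p))).fderiv
  exact congrArg (fun t ↦ t ζ) h

namespace IsMetricOn

variable [FiniteDimensional ℝ E] {G : E → E →L[ℝ] E →L[ℝ] ℝ} {U : Set E} (hG : IsMetricOn G U)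
  {k : E → ℝ} (hk : ContDiffOn ℝ ∞ k U)

include hG hk

omit [FiniteDimensional ℝ E] in
theorem contDiffOn_gradMetric : ContDiffOn ℝ ∞ (gradMetric G k) U :=
  hG.contDiffOn.add ((contDiffOn_fderiv hG.isOpen hk).smulRight (contDiffOn_fderiv hG.isOpen hk))

omit [FiniteDimensional ℝ E] in
theorem fderiv_gradMetric {x : E} (hx : x ∈ U) (z u w : E) : fderiv ℝ (gradMetric G k) x z u w
    = fderiv ℝ G x z u w + fderiv ℝ (fderiv ℝ k) x z u * fderiv ℝ k x w
      + fderiv ℝ k x u * fderiv ℝ (fderiv ℝ k) x z w := by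
  have hk' := differentiableAt_of_contDiffOn hG.isOpen (contDiffOn_fderiv hG.isOpen hk) hx
  have hK := differentiableAt_of_contDiffOn hG.isOpen (hG.contDiffOn_gradMetric hk) hx
  have hc := differentiableAt_const (𝕜 := ℝ) (x := x) (E := E) (F := E)
  have hg := hG.differentiableAt hx
  rw [← fderiv_apply_const₂ hK]
  simp only [gradMetric_apply]
  rw [fderiv_fun_add ((hg.clm_apply (hc u)).clm_apply (hc w))
    ((hk'.clm_apply (hc u)).fun_mul (hk'.clm_apply (hc w))), add_apply, fderiv_apply_const₂ hg,
    fderiv_fun_mul (hk'.clm_apply (hc u)) (hk'.clm_apply (hc w)), add_apply, smul_apply, smul_apply,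
    fderiv_apply_const hk', fderiv_apply_const hk', smul_eq_mul, smul_eq_mul]
  ring

theorem contDiffOn_gradDensity : ContDiffOn ℝ ∞ (gradDensity G k) U :=
  contDiffOn_const.add
    ((hG.contDiffOn.clm_apply (hG.contDiffOn_gradient hk)).clm_apply (hG.contDiffOn_gradient hk))

omit hk [FiniteDimensional ℝ E] in
theorem gradDensity_pos {x : E} (hx : x ∈ U) (k : E → ℝ) : 0 < gradDensity G k x := by
  rw [gradDensity]
  by_cases h : coordGrad G k x = 0
  · simp [h]
  · linarith [(hG.isInner x hx).pos _ h]

theorem contDiffOn_log_gradDensity :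
    ContDiffOn ℝ ∞ (fun y ↦ Real.log (gradDensity G k y)) U :=
  (hG.contDiffOn_gradDensity hk).log fun _ hy ↦ (hG.gradDensity_pos hy k).ne'

omit hk in
-- Inserting `grad k` into `G + dk ⊗ dk` gives `(1 + ‖grad k‖²) dk`; the density is therefore the
-- factor to divide by.
theorem gradMetric_inverse {x : E} (hx : x ∈ U) (k : E → ℝ) :
    (gradMetric G k x).inverse (fderiv ℝ k x) = (gradDensity G k x)⁻¹ • coordGrad G k x := by
  have hα := (hG.gradDensity_pos hx k).ne'
  rw [((hG.isInner x hx).gradMetric k).inverse_eq_iff]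
  intro w
  simp only [gradMetric_apply, map_smul, smul_apply, smul_eq_mul, hG.metric_gradient hx]
  have h1 : fderiv ℝ k x (coordGrad G k x) = gradDensity G k x - 1 := by
    rw [gradDensity, hG.metric_gradient hx]
    ring
  rw [h1]
  field_simp
  ring

/-- The density differs from `‖grad k‖²` by a constant, and the derivative of that norm is `2 Hess
k(·, grad k)`. -/
theorem metric_gradient_log_gradDensity {x : E} (hx : x ∈ U) (z : E) :
    G x (coordGrad G (fun y ↦ Real.log (gradDensity G k y)) x) z
      = 2 * (gradDensity G k x)⁻¹ * hessian G k x z (coordGrad G k x) := by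
  have hα := hG.gradDensity_pos hx k
  have h1 := hG.gradient_normSq_gradient hk hx
  have h2 := congrArg (fun t ↦ G x t z) h1
  simp only [hG.metric_gradient hx, map_smul, smul_apply, hG.metric_covDeriv_gradient hk hx] at h2
  rw [hG.metric_gradient hx, fderiv.log (differentiableAt_of_contDiffOn hG.isOpen
    (hG.contDiffOn_gradDensity hk) hx) hα.ne', smul_apply]
  have h3 : fderiv ℝ (gradDensity G k) x z
      = fderiv ℝ (fun y ↦ G y (coordGrad G k y) (coordGrad G k y)) x z := by
    unfold gradDensity
    rw [fderiv_const_add]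
  rw [h3, h2, hG.hessian_symm hk hx]
  simp only [smul_eq_mul]
  ring

variable {p : E × E} (hp : p.1 ∈ U)

theorem tangentMetric : IsMetricOn (tangentMetric G k) (U ×ˢ Set.univ) where
  isOpen := hG.isOpen.prod isOpen_univ
  isInner q hq := (hG.isInner q.1 hq.1).splitForm ((hG.isInner q.1 hq.1).gradMetric k) _
  contDiffOn := by
    have hfst : Set.MapsTo (Prod.fst : E × E → E) (U ×ˢ Set.univ) U := fun q hq ↦ hq.1
    have hΓ := hG.contDiffOn_christoffel.comp contDiff_fst.contDiffOn hfst
    have hK := (hG.contDiffOn_gradMetric hk).comp contDiff_fst.contDiffOn hfst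
    have hG' := hG.contDiffOn.comp contDiff_fst.contDiffOn hfst
    have hξ : ∀ ξ : E × E, ContDiffOn ℝ ∞ (fun q : E × E ↦ ξ.2 + christoffel G q.1 ξ.1 q.2)
        (U ×ˢ Set.univ) := fun ξ ↦
      contDiffOn_const.add ((hΓ.clm_apply contDiffOn_const).clm_apply contDiff_snd.contDiffOn)
    refine contDiffOn_clm_apply.2 fun ξ ↦ contDiffOn_clm_apply.2 fun η ↦ ?_
    simp only [tangentMetric_apply]
    exact ((hG'.clm_apply contDiffOn_const).clm_apply contDiffOn_const).add
      ((hK.clm_apply (hξ ξ)).clm_apply (hξ η))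

include hp

/-- The terms are grouped by the vertical parts `ξ.2 + Γ(ξ.1, p.2)`, which vanish at `p` for vectors
horizontal there; this removes most of them in the cases below. -/
theorem fderiv_tangentMetric (ζ ξ η : E × E) :
    fderiv ℝ (LocalGeometry.tangentMetric G k) p ζ ξ η = fderiv ℝ G p.1 ζ.1 ξ.1 η.1
      + fderiv ℝ (gradMetric G k) p.1 ζ.1 (ξ.2 + christoffel G p.1 ξ.1 p.2)
          (η.2 + christoffel G p.1 η.1 p.2)
      + gradMetric G k p.1 (fderiv ℝ (christoffel G) p.1 ζ.1 ξ.1 p.2 + christoffel G p.1 ξ.1 ζ.2)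
          (η.2 + christoffel G p.1 η.1 p.2)
      + gradMetric G k p.1 (ξ.2 + christoffel G p.1 ξ.1 p.2)
          (fderiv ℝ (christoffel G) p.1 ζ.1 η.1 p.2 + christoffel G p.1 η.1 ζ.2) := by
  have hg := hG.differentiableAt hp
  have hΓ := hG.differentiableAt_christoffel hp
  have hK := differentiableAt_of_contDiffOn hG.isOpen (hG.contDiffOn_gradMetric hk) hp
  have hg' : DifferentiableAt ℝ (fun q : E × E ↦ G q.1) p := hg.comp p differentiableAt_fst
  have hK' : DifferentiableAt ℝ (fun q : E × E ↦ gradMetric G k q.1) p :=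
    hK.comp p differentiableAt_fst
  have hΓ' : DifferentiableAt ℝ (fun q : E × E ↦ christoffel G q.1) p :=
    hΓ.comp p differentiableAt_fst
  have hc := differentiableAt_const (𝕜 := ℝ) (x := p) (E := E × E) (F := E)
  have hΓξ : ∀ ξ : E × E, DifferentiableAt ℝ (fun q : E × E ↦ christoffel G q.1 ξ.1 q.2) p :=
    fun ξ ↦ (hΓ'.clm_apply (hc _)).clm_apply differentiableAt_snd
  have hQ : ∀ ξ : E × E,
      DifferentiableAt ℝ (fun q : E × E ↦ ξ.2 + christoffel G q.1 ξ.1 q.2) p :=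
    fun ξ ↦ (hc _).add (hΓξ ξ)
  have hQ' : ∀ ξ : E × E, fderiv ℝ (fun q : E × E ↦ ξ.2 + christoffel G q.1 ξ.1 q.2) p ζ
      = fderiv ℝ (christoffel G) p.1 ζ.1 ξ.1 p.2 + christoffel G p.1 ξ.1 ζ.2 := by
    intro ξ
    rw [fderiv_fun_add (hc _) (hΓξ ξ), add_apply, fderiv_apply₂ hΓ' (hc _) differentiableAt_snd,
      fderiv_comp_fst hΓ, fderiv_snd]
    simp
  have hT : DifferentiableAt ℝ (LocalGeometry.tangentMetric G k) p :=
    (hG.tangentMetric hk).differentiableAt ⟨hp, trivial⟩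
  rw [← fderiv_apply_const₂ hT]
  simp only [tangentMetric_apply]
  rw [fderiv_fun_add ((hg'.clm_apply (hc _)).clm_apply (hc _))
    ((hK'.clm_apply (hQ ξ)).clm_apply (hQ η)), add_apply, fderiv_apply_const₂ hg',
    fderiv_apply₂ hK' (hQ ξ) (hQ η), fderiv_comp_fst hg, fderiv_comp_fst hK, hQ', hQ']
  ring

/-- Pairing with a horizontal vector sees only the base component, so the Koszul formula tested on
the horizontal lift of `z` isolates that component of the Christoffel symbols. -/
theorem two_mul_metric_christoffel_tangentMetric (ξ η : E × E) (z : E) :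
    2 * G p.1 (christoffel (LocalGeometry.tangentMetric G k) p ξ η).1 z
      = fderiv ℝ (LocalGeometry.tangentMetric G k) p ξ η (z, - christoffel G p.1 z p.2)
        + fderiv ℝ (LocalGeometry.tangentMetric G k) p η ξ (z, - christoffel G p.1 z p.2)
        - fderiv ℝ (LocalGeometry.tangentMetric G k) p (z, - christoffel G p.1 z p.2) ξ η := by
  rw [← (hG.tangentMetric hk).two_mul_christoffel ⟨hp, trivial⟩, tangentMetric_apply _ _ _ _ (z, _)]
  simp

/-- When all three vectors are horizontal at `p`, each term with `gradMetric` has a vanishing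
factor, and the Koszul formula of `G` is left. -/
theorem christoffel_tangentMetric_horizontal (u w : E) :
    (christoffel (LocalGeometry.tangentMetric G k) p (u, - christoffel G p.1 u p.2)
      (w, - christoffel G p.1 w p.2)).1 = christoffel G p.1 u w := by
  refine (hG.isInner _ hp).eq_of_forall fun z ↦ ?_
  have h1 := hG.two_mul_metric_christoffel_tangentMetric hk hp (u, - christoffel G p.1 u p.2)
    (w, - christoffel G p.1 w p.2) z
  have h2 := hG.two_mul_christoffel hp u w z
  simp only [hG.fderiv_tangentMetric hk hp, neg_add_cancel, map_zero, zero_apply, add_zero] at h1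
  linarith

/-- For vertical `u`, `w` the Koszul formula reduces to `-(∇_z K)(u, w)` with `K = G + dk ⊗ dk`.
Since `∇G = 0`, only `-∇_z(dk ⊗ dk)(u, w)` survives. -/
theorem christoffel_tangentMetric_vertical (u w z : E) :
    2 * G p.1 (christoffel (LocalGeometry.tangentMetric G k) p (0, u) (0, w)).1 z
      = - (hessian G k p.1 z u * fderiv ℝ k p.1 w + hessian G k p.1 z w * fderiv ℝ k p.1 u) := by
  rw [hG.two_mul_metric_christoffel_tangentMetric hk hp]
  simp only [hG.fderiv_tangentMetric hk hp, neg_add_cancel, map_zero, zero_apply, add_zero,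
    zero_add, hG.fderiv_gradMetric hk hp, hG.fderiv_metric hp, gradMetric_apply, hessian_apply,
    (hG.isInner _ hp).symm w]
  ring

/-- Each of the two Hessian terms has `K`-trace `α⁻¹ Hess k(z, grad k)`, which is half the
derivative of `ln α` along `z`. -/
theorem metricTrace_christoffel_tangentMetric_vertical :
    metricTrace (gradMetric G k p.1)
        (fun u w ↦ (christoffel (LocalGeometry.tangentMetric G k) p (0, u) (0, w)).1)
      = - (1 / 2 : ℝ) • coordGrad G (fun y ↦ Real.log (gradDensity G k y)) p.1 := by
  refine (hG.isInner _ hp).eq_of_forall fun z ↦ ?_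
  have hb := (hG.isInner _ hp).gradMetric k
  have hz := fun B : E → E → E ↦ metricTrace_map (b := gradMetric G k p.1) ((G p.1).flip z) B
  simp only [ContinuousLinearMap.flip_apply] at hz
  rw [← hz]
  have h1 : ∀ u w, G p.1 (christoffel (LocalGeometry.tangentMetric G k) p (0, u) (0, w)).1 z
      = - (1 / 2 : ℝ) • (hessian G k p.1 z u * fderiv ℝ k p.1 w
        + fderiv ℝ k p.1 u * hessian G k p.1 z w) := by
    intro u w
    have := hG.christoffel_tangentMetric_vertical hk hp u w z
    rw [smul_eq_mul]
    linarith
  simp only [h1]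
  have h2 := metricTrace_symm_apply hb ((hessian G k p.1 z).smulRight (fderiv ℝ k p.1))
  simp only [ContinuousLinearMap.smulRight_apply, smul_apply, smul_eq_mul] at h2
  rw [metricTrace_const_smul, metricTrace_add]
  simp only [mul_comm (fderiv ℝ k p.1 _)]
  rw [← h2, metricTrace_mul hb, hG.gradMetric_inverse hp, map_smul, map_smul, smul_apply,
    hG.metric_gradient_log_gradDensity hk hp]
  simp only [smul_eq_mul]
  ring

end IsMetricOn

end LocalGeometry

/-! ### Tension and bitension of the projection in coordinates -/

namespace LocalGeometry

open Filter Topology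

variable {E : Type*} [NormedAddCommGroup E] [NormedSpace ℝ E]

theorem fderiv_eventuallyEq_fst {φ : E × E → E} {p : E × E} (hφ : φ =ᶠ[𝓝 p] Prod.fst) :
    fderiv ℝ φ =ᶠ[𝓝 p] fun _ ↦ ContinuousLinearMap.fst ℝ E E := by
  filter_upwards [hφ.fderiv (𝕜 := ℝ)] with q hq
  rw [hq, fderiv_fst]

theorem christoffel_congr {G G' : E → E →L[ℝ] E →L[ℝ] ℝ} {x : E}
    (h : G =ᶠ[𝓝 x] G') : christoffel G x = christoffel G' x := by
  simp only [christoffel, h.fderiv_eq, h.eq_of_nhds]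

namespace IsMetricOn

variable [FiniteDimensional ℝ E] {G : E → E →L[ℝ] E →L[ℝ] ℝ} {U : Set E} (hG : IsMetricOn G U)
  {k : E → ℝ} (hk : ContDiffOn ℝ ∞ k U) {p : E × E} (hp : p.1 ∈ U)
  {Gt : E × E → E × E →L[ℝ] E × E →L[ℝ] ℝ} (hGt : Gt =ᶠ[𝓝 p] LocalGeometry.tangentMetric G k)
  {φ : E × E → E} (hφ : φ =ᶠ[𝓝 p] Prod.fst)

include hG hk hp hGt

/-- The common core of the tension, rough Laplacian and curvature traces. The horizontal half
reproduces the trace over the base; in the vertical half `B` vanishes and the Christoffel term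
contributes `½ T(grad ln α)`. -/
theorem metricTrace_tangentMetric {F : Type*} [NormedAddCommGroup F] [NormedSpace ℝ F]
    (B : E →L[ℝ] E →L[ℝ] F) (T : E →L[ℝ] F) :
    metricTrace (Gt p) (fun ξ η ↦ B ξ.1 η.1 - T (christoffel Gt p ξ η).1)
      = metricTrace (G p.1) (fun u w ↦ B u w - T (christoffel G p.1 u w))
        + (1 / 2 : ℝ) • T (coordGrad G (fun y ↦ Real.log (gradDensity G k y)) p.1) := by
  rw [hGt.eq_of_nhds, christoffel_congr hGt]
  have hb := hG.isInner _ hp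
  have h1 := metricTrace_splitForm hb (hb.gradMetric k) ((christoffel G p.1).flip p.2)
    (B.bilinearComp (ContinuousLinearMap.fst ℝ E E) (ContinuousLinearMap.fst ℝ E E)
      - (ContinuousLinearMap.compL ℝ (E × E) (E × E) F (T ∘L ContinuousLinearMap.fst ℝ E E)) ∘L
        christoffel (LocalGeometry.tangentMetric G k) p)
  refine h1.trans ?_
  have h2 : ∀ u w : E, (christoffel (LocalGeometry.tangentMetric G k) p
      (u, -(christoffel G p.1).flip p.2 u) (w, -(christoffel G p.1).flip p.2 w)).1
      = christoffel G p.1 u w := hG.christoffel_tangentMetric_horizontal hk hp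
  simp only [sub_apply, ContinuousLinearMap.bilinearComp_apply, ContinuousLinearMap.coe_fst',
    ContinuousLinearMap.comp_apply, ContinuousLinearMap.compL_apply, h2, map_zero, zero_sub]
  rw [metricTrace_neg, metricTrace_map, hG.metricTrace_christoffel_tangentMetric_vertical hk hp]
  simp

include hφ

theorem tension_fst : tension Gt G φ p
    = (1 / 2 : ℝ) • coordGrad G (fun y ↦ Real.log (gradDensity G k y)) p.1 := by
  have hd := fderiv_eventuallyEq_fst hφ
  -- With `B = Γ` and `T = id` the base trace cancels identically, leaving the vertical contribution
  -- alone.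
  have h1 := hG.metricTrace_tangentMetric hk hp hGt (christoffel G p.1)
    (ContinuousLinearMap.id ℝ E)
  simp only [ContinuousLinearMap.id_apply, sub_self] at h1
  have h2 : metricTrace (G p.1) (fun _ _ ↦ (0 : E)) = 0 := Finset.sum_const_zero
  rw [h2, zero_add] at h1
  rw [← h1, tension]
  simp only [hd.fderiv_eq, hd.eq_of_nhds, hφ.eq_of_nhds]
  simp

/-- A field pulled back from the base has as pull-back derivatives the covariant derivatives of `W`
along base components. The core trace formula then applies with `T = ∇W` for the rough Laplacian and
with `T = 0` for the curvature term. -/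
theorem jacobi_fst {W : E → E} (hW : ContDiffOn ℝ ∞ W U) {V : E × E → E}
    (hV : V =ᶠ[𝓝 p] fun q ↦ W q.1) : jacobi Gt G φ V p
    = - (ricci G p.1 (W p.1) + metricTrace (G p.1) (fun u w ↦ secondCovDeriv G W p.1 u w)
      + (1 / 2 : ℝ) • covDeriv G W p.1
        (coordGrad G (fun y ↦ Real.log (gradDensity G k y)) p.1)) := by
  have hd := fderiv_eventuallyEq_fst hφ
  have hU : ∀ᶠ q : E × E in 𝓝 p, q.1 ∈ U :=
    continuous_fst.continuousAt.preimage_mem_nhds (hG.isOpen.mem_nhds hp)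
  have hcov : ∀ w : E × E, (fun q ↦ covDerivAlong G φ V q w)
      =ᶠ[𝓝 p] fun q ↦ covDeriv G W q.1 w.1 := by
    intro w
    filter_upwards [hd, hφ, hV, hU, hV.fderiv (𝕜 := ℝ)] with q h1 h2 h3 h4 h5
    rw [covDerivAlong, h1, h2, h3, h5,
      fderiv_comp_fst (differentiableAt_of_contDiffOn hG.isOpen hW h4), covDeriv_apply]
    rfl
  have hC := differentiableAt_of_contDiffOn hG.isOpen (hG.contDiffOn_covDeriv hW) hp
  have hcov₂ : ∀ u w : E × E, covDerivAlong G φ (fun z ↦ covDerivAlong G φ V z w) p u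
      = fderiv ℝ (covDeriv G W) p.1 u.1 w.1 + christoffel G p.1 u.1 (covDeriv G W p.1 w.1) := by
    intro u w
    rw [covDerivAlong, (hcov w).fderiv_eq, hd.eq_of_nhds, hφ.eq_of_nhds, (hcov w).eq_of_nhds,
      fderiv_comp_fst (hC.clm_apply (differentiableAt_const _)), fderiv_apply_const hC]
    rfl
  have hrough : roughLaplacian Gt G φ V p
      = metricTrace (G p.1) (fun u w ↦ secondCovDeriv G W p.1 u w)
        + (1 / 2 : ℝ) • covDeriv G W p.1
          (coordGrad G (fun y ↦ Real.log (gradDensity G k y)) p.1) := by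
    have h1 := hG.metricTrace_tangentMetric hk hp hGt
      (fderiv ℝ (covDeriv G W) p.1
        + (ContinuousLinearMap.compL ℝ E E E).flip (covDeriv G W p.1) ∘L christoffel G p.1)
      (covDeriv G W p.1)
    rw [roughLaplacian]
    simp only [hcov₂, fun w ↦ (hcov w).eq_of_nhds]
    exact h1
  have hcurv : metricTrace (Gt p) (fun u w ↦
      curvature G (φ p) (V p) (fderiv ℝ φ p u) (fderiv ℝ φ p w)) = ricci G p.1 (W p.1) := by
    have h1 := hG.metricTrace_tangentMetric hk hp hGt (curvatureForm G p.1 (W p.1)) 0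
    simp only [zero_apply, sub_zero, smul_zero, add_zero] at h1
    rw [hd.eq_of_nhds, hφ.eq_of_nhds, hV.eq_of_nhds]
    exact h1
  rw [jacobi, hrough, hcurv]
  abel

/-- The bitension field of the projection of the tangent bundle, in coordinates. -/
theorem jacobi_tension_fst {V : E × E → E}
    (hV : V =ᶠ[𝓝 p] fun q ↦
      (1 / 2 : ℝ) • coordGrad G (fun y ↦ Real.log (gradDensity G k y)) q.1) :
    jacobi Gt G φ V p
      = - (ricci G p.1 (coordGrad G (fun y ↦ Real.log (gradDensity G k y)) p.1)
        + (1 / 2 : ℝ) • coordGrad G (laplacian G (fun y ↦ Real.log (gradDensity G k y))) p.1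
        + (1 / 8 : ℝ) • coordGrad G (fun y ↦
          G y (coordGrad G (fun y ↦ Real.log (gradDensity G k y)) y)
            (coordGrad G (fun y ↦ Real.log (gradDensity G k y)) y)) p.1) := by
  have hl := hG.contDiffOn_log_gradDensity hk
  set l := fun y ↦ Real.log (gradDensity G k y)
  have hW := hG.contDiffOn_gradient hl
  have hWd : ∀ y ∈ U, DifferentiableAt ℝ (coordGrad G l) y :=
    fun y hy ↦ differentiableAt_of_contDiffOn hG.isOpen hW hy
  have hcov : ∀ y ∈ U, covDeriv G (fun y ↦ (1 / 2 : ℝ) • coordGrad G l y) y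
      = (1 / 2 : ℝ) • covDeriv G (coordGrad G l) y := by
    intro y hy
    ext u
    rw [covDeriv_apply, fderiv_fun_const_smul (hWd y hy), smul_apply, smul_apply,
      covDeriv_apply, map_smul, smul_add]
  have hsec : ∀ u w, secondCovDeriv G (fun y ↦ (1 / 2 : ℝ) • coordGrad G l y) p.1 u w
      = (1 / 2 : ℝ) • secondCovDeriv G (coordGrad G l) p.1 u w := by
    intro u w
    have hC := differentiableAt_of_contDiffOn hG.isOpen (hG.contDiffOn_covDeriv hW) hp
    rw [secondCovDeriv_apply, secondCovDeriv_apply, fderiv_eq_of_eqOn hG.isOpen hcov hp,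
      hcov _ hp, fderiv_fun_const_smul hC]
    simp only [smul_apply, map_smul, smul_add, smul_sub]
  have hric : ricci G p.1 ((1 / 2 : ℝ) • coordGrad G l p.1)
      = (1 / 2 : ℝ) • ricci G p.1 (coordGrad G l p.1) := by
    rw [ricci, ricci, ← metricTrace_const_smul]
    congr 1
    ext u w
    simp only [curvature, map_smul, smul_apply, smul_add, smul_sub]
  rw [hG.jacobi_fst hk hp hGt hφ (hW.const_smul (1 / 2 : ℝ)) hV]
  simp only [hsec, hric, hcov _ hp, metricTrace_const_smul,
    hG.metricTrace_secondCovDeriv_gradient hl hp, hG.gradient_normSq_gradient hl hp, smul_apply]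
  -- The Ricci coefficient is `½` from the curvature term plus `½` from the Weitzenböck formula; the
  -- coefficient `¼` of `∇_{grad l} grad l` becomes `⅛` because the gradient of `‖grad l‖²` is twice
  -- that vector.
  module

end IsMetricOn

/-! ### Behaviour under changes of coordinates -/

section CoordinateChange

variable {G G' : E → E →L[ℝ] E →L[ℝ] ℝ} {ψ : E → E} {x : E}

/-- The transformation law of the Christoffel symbols. -/
theorem christoffel_pullback [FiniteDimensional ℝ E] (hψ : ContDiffAt ℝ ∞ ψ x)
    (hψ' : (fderiv ℝ ψ x).IsInvertible) (hG : (G x).IsInvertible) (hG' : IsInner (G' (ψ x)))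
    (hGd : DifferentiableAt ℝ G' (ψ x))
    (h : ∀ᶠ y in 𝓝 x, ∀ u v, G y u v = G' (ψ y) (fderiv ℝ ψ y u) (fderiv ℝ ψ y v))
    (hGx : DifferentiableAt ℝ G x)
    (u v : E) : fderiv ℝ ψ x (christoffel G x u v)
      = fderiv ℝ (fderiv ℝ ψ) x u v
        + christoffel G' (ψ x) (fderiv ℝ ψ x u) (fderiv ℝ ψ x v) := by
  have hψ₁ : DifferentiableAt ℝ ψ x := hψ.differentiableAt (by simp)
  have hψ₂ : DifferentiableAt ℝ (fderiv ℝ ψ) x :=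
    (hψ.fderiv_right (m := 1) (WithTop.coe_le_coe.2 le_top)).differentiableAt (by simp)
  have hs : ∀ u v, fderiv ℝ (fderiv ℝ ψ) x u v = fderiv ℝ (fderiv ℝ ψ) x v u := fun u v ↦
    (hψ.isSymmSndFDerivAt (by
      simp only [minSmoothness_of_isRCLikeNormedField]
      exact WithTop.coe_le_coe.2 le_top)).eq u v
  have hc := differentiableAt_const (𝕜 := ℝ) (x := x) (E := E) (F := E)
  have hD : ∀ z u v, fderiv ℝ G x z u v
      = fderiv ℝ G' (ψ x) (fderiv ℝ ψ x z) (fderiv ℝ ψ x u) (fderiv ℝ ψ x v)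
        + G' (ψ x) (fderiv ℝ (fderiv ℝ ψ) x z u) (fderiv ℝ ψ x v)
        + G' (ψ x) (fderiv ℝ ψ x u) (fderiv ℝ (fderiv ℝ ψ) x z v) := by
    intro z u v
    have h1 : (fun y ↦ G y u v)
        =ᶠ[𝓝 x] fun y ↦ (G' ∘ ψ) y (fderiv ℝ ψ y u) (fderiv ℝ ψ y v) := h.mono fun y hy ↦ hy u v
    rw [← fderiv_apply_const₂ hGx, h1.fderiv_eq, fderiv_apply₂ (hGd.comp x hψ₁)
      (hψ₂.clm_apply (hc u)) (hψ₂.clm_apply (hc v)), fderiv_comp _ hGd hψ₁,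
      fderiv_apply_const hψ₂, fderiv_apply_const hψ₂]
    rfl
  refine hG'.eq_of_forall fun w' ↦ ?_
  -- Every test vector is some `dψ w`, so the Koszul formulas of `G` and `G'` can be compared;
  -- symmetry of the second derivative of `ψ` cancels all its terms but the one with `u`, `v`.
  obtain ⟨w, rfl⟩ := hψ'.surjective w'
  have h1 := two_mul_metric_christoffel hG u v w
  have h2 := two_mul_metric_christoffel hG'.isInvertible (fderiv ℝ ψ x u) (fderiv ℝ ψ x v)
    (fderiv ℝ ψ x w)
  rw [h.self_of_nhds] at h1
  simp only [hD] at h1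
  rw [map_add, add_apply]
  rw [hs w u, hs w v, hs v u, hG'.symm (fderiv ℝ ψ x u) (fderiv ℝ (fderiv ℝ ψ) x v w),
    hG'.symm (fderiv ℝ (fderiv ℝ ψ) x u w) (fderiv ℝ ψ x v)] at h1
  rw [hG'.symm (fderiv ℝ ψ x v)] at h1
  linarith

/-- The Laplacian is invariant under changes of coordinates. -/
theorem laplacian_pullback [FiniteDimensional ℝ E] (hψ : ContDiffAt ℝ ∞ ψ x)
    (hψ' : (fderiv ℝ ψ x).IsInvertible) (hG : IsInner (G x)) (hG' : IsInner (G' (ψ x)))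
    (hGd : DifferentiableAt ℝ G' (ψ x))
    (h : ∀ᶠ y in 𝓝 x, ∀ u v, G y u v = G' (ψ y) (fderiv ℝ ψ y u) (fderiv ℝ ψ y v))
    (hGx : DifferentiableAt ℝ G x)
    {k k' : E → ℝ} (hk' : ContDiffAt ℝ ∞ k' (ψ x)) (hk : k =ᶠ[𝓝 x] k' ∘ ψ) :
    laplacian G k x = laplacian G' k' (ψ x) := by
  have hψ₁ : DifferentiableAt ℝ ψ x := hψ.differentiableAt (by simp)
  have hψ₂ : DifferentiableAt ℝ (fderiv ℝ ψ) x :=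
    (hψ.fderiv_right (m := 1) (WithTop.coe_le_coe.2 le_top)).differentiableAt (by simp)
  have hk₂ : DifferentiableAt ℝ (fderiv ℝ k') (ψ x) :=
    (hk'.fderiv_right (m := 1) (WithTop.coe_le_coe.2 le_top)).differentiableAt (by simp)
  have e : fderiv ℝ k =ᶠ[𝓝 x] fun y ↦ (fderiv ℝ k' (ψ y)) ∘L fderiv ℝ ψ y := by
    have h1 : ∀ᶠ y in 𝓝 x, DifferentiableAt ℝ ψ y := by
      filter_upwards [(hψ.of_le (m := 1) (WithTop.coe_le_coe.2 le_top)).eventually (by simp)]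
        with y hy using hy.differentiableAt (by simp)
    have h2 : ∀ᶠ y in 𝓝 x, DifferentiableAt ℝ k' (ψ y) := by
      refine hψ₁.continuousAt.eventually ?_
      filter_upwards [(hk'.of_le (m := 1) (WithTop.coe_le_coe.2 le_top)).eventually (by simp)]
        with y hy using hy.differentiableAt (by simp)
    filter_upwards [hk.fderiv (𝕜 := ℝ), h1, h2] with y hy h1 h2
    rw [hy, fderiv_comp _ h2 h1]
  obtain ⟨T, hT⟩ := hψ'
  have hTu : ∀ u, T u = fderiv ℝ ψ x u := fun u ↦ by rw [← hT]; rfl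
  -- The second derivative of `ψ` in the chain rule cancels against the inhomogeneous term of the
  -- Christoffel law, so the Hessian is a tensor.
  have hhess : ∀ u w, hessian G k x u w = hessian G' k' (ψ x) (T u) (T w) := by
    intro u w
    have hc := differentiableAt_const (𝕜 := ℝ) (x := x) (E := E) (F := E)
    have h1 : fderiv ℝ (fderiv ℝ k) x u w
        = fderiv ℝ (fderiv ℝ k') (ψ x) (fderiv ℝ ψ x u) (fderiv ℝ ψ x w)
          + fderiv ℝ k' (ψ x) (fderiv ℝ (fderiv ℝ ψ) x u w) := by
      have hcomp : DifferentiableAt ℝ (fun y ↦ (fderiv ℝ k' (ψ y)) ∘L fderiv ℝ ψ y) x :=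
        (hk₂.comp x hψ₁).clm_comp hψ₂
      rw [e.fderiv_eq, ← fderiv_apply_const hcomp]
      have := fderiv_apply₁ (hk₂.comp x hψ₁) (hψ₂.clm_apply (hc w)) u
      rw [fderiv_comp _ hk₂ hψ₁, fderiv_apply_const hψ₂] at this
      exact this
    rw [hessian_apply, hessian_apply, h1, e.self_of_nhds, ContinuousLinearMap.comp_apply,
      christoffel_pullback hψ ⟨T, hT⟩ hG.isInvertible hG' hGd h hGx, map_add, hTu, hTu]
    ring
  have h1 := metricTrace_isometry hG hG' T (fun u v ↦ by rw [hTu, hTu, h.self_of_nhds])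
    (hessian G' k' (ψ x))
  simp only [← hhess] at h1
  exact h1

end CoordinateChange

end LocalGeometry

/-! ### Preferred charts and their transition maps -/

section Charts

open Filter Topology LocalGeometry

variable {E : Type*} [NormedAddCommGroup E] [NormedSpace ℝ E]
  {H : Type*} [TopologicalSpace H] {I : ModelWithCorners ℝ E H}
  {M : Type*} [TopologicalSpace M] [ChartedSpace H M]

/-- The derivative of an inverse chart is a coordinate change. -/
theorem mfderivWithin_extChartAt_symm_eq_fderivWithin [IsManifold I 1 M] {x₀ : M} {y : E}
    (hy : y ∈ (extChartAt I x₀).target) :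
    (mfderivWithin 𝓘(ℝ, E) I (extChartAt I x₀).symm (Set.range I) y : E →L[ℝ] E)
      = fderivWithin ℝ (extChartAt I ((extChartAt I x₀).symm y) ∘ (extChartAt I x₀).symm)
        (Set.range I) y := by
  rw [(mdifferentiableWithinAt_extChartAt_symm hy).mfderivWithin]
  simp only [writtenInExtChartAt, extChartAt_model_space_eq_id, PartialEquiv.refl_symm,
    PartialEquiv.refl_coe, Function.comp_id, Set.preimage_id, id,
    ModelWithCorners.range_eq_univ 𝓘(ℝ, E), Set.inter_univ]
  rfl

/-- A field of bilinear forms, in the preferred chart at each point. -/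
def formAt (g : BilinField I M) (x : M) : E →L[ℝ] E →L[ℝ] ℝ := g x

/-- The differential of a function, in the preferred chart at each point. -/
def differentialAt (I : ModelWithCorners ℝ E H) {M : Type*} [TopologicalSpace M]
    [ChartedSpace H M] (k : M → ℝ) (x : M) : E →L[ℝ] ℝ := mvfderiv I k x

end Charts

section CoordinateTransitions

open Filter Topology LocalGeometry

variable {E : Type*} [NormedAddCommGroup E] [NormedSpace ℝ E]
  {M : Type*} [TopologicalSpace M] [ChartedSpace E M]

/-- The coordinate change from the preferred chart at `x₀` to that at `x₁`. -/
def coordTransition (x₀ x₁ : M) : E → E :=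
  extChartAt 𝓘(ℝ, E) x₁ ∘ (extChartAt 𝓘(ℝ, E) x₀).symm

/-- The derivative at `y` of the inverse of the preferred chart at `x₀`, in the preferred chart of
its target point. -/
def chartDeriv (x₀ : M) (y : E) : E →L[ℝ] E :=
  fderiv ℝ (coordTransition x₀ ((extChartAt 𝓘(ℝ, E) x₀).symm y)) y

variable [IsManifold 𝓘(ℝ, E) ∞ M]

theorem mfderivWithin_extChartAt_symm_eq_chartDeriv {x₀ : M} {y : E}
    (hy : y ∈ (extChartAt 𝓘(ℝ, E) x₀).target) :
    (mfderivWithin 𝓘(ℝ, E) 𝓘(ℝ, E) (extChartAt 𝓘(ℝ, E) x₀).symm (Set.range 𝓘(ℝ, E)) y : E →L[ℝ] E)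
      = chartDeriv x₀ y := by
  have : IsManifold 𝓘(ℝ, E) 1 M := IsManifold.of_le (n := ∞) (by exact_mod_cast le_top)
  rw [mfderivWithin_extChartAt_symm_eq_fderivWithin hy, chartDeriv, coordTransition]
  simp only [ModelWithCorners.range_eq_univ, fderivWithin_univ]
  rfl

theorem contDiffAt_coordTransition {x₀ x₁ : M} {y : E}
    (hy : y ∈ (extChartAt 𝓘(ℝ, E) x₀).target)
    (hy' : (extChartAt 𝓘(ℝ, E) x₀).symm y ∈ (extChartAt 𝓘(ℝ, E) x₁).source) :
    ContDiffAt ℝ ∞ (coordTransition x₀ x₁) y := by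
  have h := contDiffWithinAt_ext_coord_change (I := 𝓘(ℝ, E)) (n := ∞) x₁ x₀ (y := y) (by
    rw [PartialEquiv.trans_source]
    exact ⟨hy, hy'⟩)
  rwa [ModelWithCorners.range_eq_univ, contDiffWithinAt_univ] at h

theorem isInvertible_chartDeriv {x₀ : M} {y : E}
    (hy : y ∈ (extChartAt 𝓘(ℝ, E) x₀).target) : (chartDeriv x₀ y).IsInvertible := by
  have : IsManifold 𝓘(ℝ, E) 1 M := IsManifold.of_le (n := ∞) (by exact_mod_cast le_top)
  rw [← mfderivWithin_extChartAt_symm_eq_chartDeriv hy]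
  exact isInvertible_mfderivWithin_extChartAt_symm hy

theorem chartDeriv_self (x₀ : M) :
    chartDeriv x₀ (extChartAt 𝓘(ℝ, E) x₀ x₀) = ContinuousLinearMap.id ℝ E := by
  have : IsManifold 𝓘(ℝ, E) 1 M := IsManifold.of_le (n := ∞) (by exact_mod_cast le_top)
  rw [← mfderivWithin_extChartAt_symm_eq_chartDeriv (mem_extChartAt_target x₀)]
  exact mfderivWithin_range_extChartAt_symm

/-- The chain rule for coordinate changes. -/
theorem chartDeriv_comp {x₀ x₁ : M} {y : E} (hy : y ∈ (extChartAt 𝓘(ℝ, E) x₀).target)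
    (hy' : (extChartAt 𝓘(ℝ, E) x₀).symm y ∈ (extChartAt 𝓘(ℝ, E) x₁).source) (v : E) :
    chartDeriv x₁ (coordTransition x₀ x₁ y) (fderiv ℝ (coordTransition x₀ x₁) y v)
      = chartDeriv x₀ y v := by
  have : IsManifold 𝓘(ℝ, E) 1 M := IsManifold.of_le (n := ∞) (by exact_mod_cast le_top)
  have h := tangentCoordChange_comp (I := 𝓘(ℝ, E)) (w := x₀) (x := x₁)
    (y := (extChartAt 𝓘(ℝ, E) x₀).symm y) (z := (extChartAt 𝓘(ℝ, E) x₀).symm y) (v := v)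
    ⟨⟨(extChartAt 𝓘(ℝ, E) x₀).map_target hy, hy'⟩, mem_extChartAt_source _⟩
  simp only [tangentCoordChange_def, (extChartAt 𝓘(ℝ, E) x₀).right_inv hy,
    ModelWithCorners.range_eq_univ, fderivWithin_univ] at h
  rw [chartDeriv, chartDeriv]
  have e : (extChartAt 𝓘(ℝ, E) x₁).symm (coordTransition x₀ x₁ y)
      = (extChartAt 𝓘(ℝ, E) x₀).symm y := (extChartAt 𝓘(ℝ, E) x₁).left_inv hy'
  rw [e]
  exact h

theorem metricInChart_eq (g : BilinField 𝓘(ℝ, E) M) {x₀ : M} {y : E}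
    (hy : y ∈ (extChartAt 𝓘(ℝ, E) x₀).target) (u v : E) :
    metricInChart g x₀ y u v = formAt g ((extChartAt 𝓘(ℝ, E) x₀).symm y)
      (chartDeriv x₀ y u) (chartDeriv x₀ y v) := by
  rw [← mfderivWithin_extChartAt_symm_eq_chartDeriv hy]
  rfl

/-- By the cocycle identity, the coordinate field with components `u` is constant in the
trivialization at `x₀`. This gives its smoothness below. -/
theorem trivializationAt_chartDeriv {x₀ : M} {y : E}
    (hy : y ∈ (extChartAt 𝓘(ℝ, E) x₀).target) (u : E) :
    (trivializationAt E (fun x : M ↦ TangentSpace 𝓘(ℝ, E) x) x₀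
      (TotalSpace.mk' E ((extChartAt 𝓘(ℝ, E) x₀).symm y) (chartDeriv x₀ y u))).2 = u := by
  have : IsManifold 𝓘(ℝ, E) 1 M := IsManifold.of_le (n := ∞) (by exact_mod_cast le_top)
  have hz := (extChartAt 𝓘(ℝ, E) x₀).map_target hy
  have h := tangentCoordChange_comp (I := 𝓘(ℝ, E)) (w := x₀)
    (x := (extChartAt 𝓘(ℝ, E) x₀).symm y) (y := x₀) (v := u) ⟨⟨hz, mem_extChartAt_source _⟩, hz⟩
  rw [tangentCoordChange_self hz] at h
  rw [tangentCoordChange_def (x := x₀), (extChartAt 𝓘(ℝ, E) x₀).right_inv hy,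
    ModelWithCorners.range_eq_univ, fderivWithin_univ] at h
  exact h

/-- The expressions of a metric in two charts. -/
theorem metricInChart_coordTransition (g : BilinField 𝓘(ℝ, E) M) {x₀ x₁ : M} {y : E}
    (hy : y ∈ (extChartAt 𝓘(ℝ, E) x₀).target)
    (hy' : (extChartAt 𝓘(ℝ, E) x₀).symm y ∈ (extChartAt 𝓘(ℝ, E) x₁).source) (u v : E) :
    metricInChart g x₀ y u v = metricInChart g x₁ (coordTransition x₀ x₁ y)
      (fderiv ℝ (coordTransition x₀ x₁) y u) (fderiv ℝ (coordTransition x₀ x₁) y v) := by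
  have hy₁ : coordTransition x₀ x₁ y ∈ (extChartAt 𝓘(ℝ, E) x₁).target :=
    (extChartAt 𝓘(ℝ, E) x₁).map_source hy'
  rw [metricInChart_eq g hy, metricInChart_eq g hy₁, chartDeriv_comp hy hy',
    chartDeriv_comp hy hy']
  have e : (extChartAt 𝓘(ℝ, E) x₁).symm (coordTransition x₀ x₁ y)
      = (extChartAt 𝓘(ℝ, E) x₀).symm y := (extChartAt 𝓘(ℝ, E) x₁).left_inv hy'
  rw [e]

theorem fderiv_comp_extChartAt_symm {k : M → ℝ} {x₀ : M} {y : E}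
    (hy : y ∈ (extChartAt 𝓘(ℝ, E) x₀).target)
    (hk : MDifferentiableAt 𝓘(ℝ, E) 𝓘(ℝ) k ((extChartAt 𝓘(ℝ, E) x₀).symm y)) (u : E) :
    fderiv ℝ (k ∘ (extChartAt 𝓘(ℝ, E) x₀).symm) y u
      = differentialAt 𝓘(ℝ, E) k ((extChartAt 𝓘(ℝ, E) x₀).symm y)
        (chartDeriv x₀ y u) := by
  have : IsManifold 𝓘(ℝ, E) 1 M := IsManifold.of_le (n := ∞) (by exact_mod_cast le_top)
  have h1 := mdifferentiableWithinAt_extChartAt_symm (I := 𝓘(ℝ, E)) hy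
  have h2 := mfderivWithin_extChartAt_symm_eq_chartDeriv hy
  simp only [ModelWithCorners.range_eq_univ, mdifferentiableWithinAt_univ,
    mfderivWithin_univ] at h1 h2
  rw [← h2, ← mfderiv_eq_fderiv, mfderiv_comp y hk h1]
  rfl

theorem mfderiv_extChartAt_chartDeriv {x₀ : M} {y : E}
    (hy : y ∈ (extChartAt 𝓘(ℝ, E) x₀).target) (u : E) :
    (mfderiv 𝓘(ℝ, E) 𝓘(ℝ, E) (extChartAt 𝓘(ℝ, E) x₀) ((extChartAt 𝓘(ℝ, E) x₀).symm y) : E →L[ℝ] E)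
      (chartDeriv x₀ y u) = u := by
  have : IsManifold 𝓘(ℝ, E) 1 M := IsManifold.of_le (n := ∞) (by exact_mod_cast le_top)
  have h := mfderiv_extChartAt_comp_mfderivWithin_extChartAt_symm (I := 𝓘(ℝ, E)) hy
  rw [← mfderivWithin_extChartAt_symm_eq_chartDeriv hy]
  exact congrArg (fun t : E →L[ℝ] E ↦ t u) h

end CoordinateTransitions

/-! ### Metric, gradient and Laplacian of the manifold read in a fixed chart -/

section Riemannian

open Filter Topology LocalGeometry

variable {E : Type*} [NormedAddCommGroup E] [NormedSpace ℝ E] [FiniteDimensional ℝ E]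
  {M : Type*} [TopologicalSpace M] [ChartedSpace E M] [IsManifold 𝓘(ℝ, E) ∞ M]
  (g : ContMDiffRiemannianMetric 𝓘(ℝ, E) ∞ E (fun x : M ↦ TangentSpace 𝓘(ℝ, E) x))

omit [FiniteDimensional ℝ E] in
theorem isInner_inner (x : M) : IsInner (E := E) (g.inner x) :=
  ⟨g.symm x, g.pos x⟩

/-- A Riemannian metric is a metric in each chart. -/
theorem isMetricOn_metricInChart (x₀ : M) :
    IsMetricOn (metricInChart g.inner x₀) (extChartAt 𝓘(ℝ, E) x₀).target where
  isOpen := isOpen_extChartAt_target x₀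
  isInner y hy := by
    refine ⟨fun u v ↦ ?_, fun u hu ↦ ?_⟩
    · rw [metricInChart_eq _ hy, metricInChart_eq _ hy]
      exact g.symm _ _ _
    · rw [metricInChart_eq _ hy]
      refine g.pos _ _ fun h ↦ hu ?_
      exact (isInvertible_chartDeriv hy).injective (h.trans (map_zero _).symm)
  contDiffOn := by
    have : IsManifold 𝓘(ℝ, E) 1 M := IsManifold.of_le (n := ∞) (by exact_mod_cast le_top)
    refine contDiffOn_clm_apply.2 fun u ↦ contDiffOn_clm_apply.2 fun v ↦ ?_
    set c := extChartAt 𝓘(ℝ, E) x₀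
    have hc : ContMDiffOn 𝓘(ℝ, E) 𝓘(ℝ, E) ∞ c.symm c.target := contMDiffOn_extChartAt_symm x₀
    have hg : ContMDiffOn 𝓘(ℝ, E) (𝓘(ℝ, E).prod 𝓘(ℝ, E →L[ℝ] E →L[ℝ] ℝ)) ∞
        (fun y ↦ TotalSpace.mk' (E →L[ℝ] E →L[ℝ] ℝ)
          (E := fun x : M ↦ TangentSpace 𝓘(ℝ, E) x →L[ℝ] TangentSpace 𝓘(ℝ, E) x →L[ℝ] ℝ)
          (c.symm y) (g.inner (c.symm y))) c.target :=
      g.contMDiff.comp_contMDiffOn hc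
    -- Coordinate vector fields are smooth sections; the components of the metric are the smooth
    -- tensor `g` evaluated on two of them.
    have hs : ∀ u : E, ContMDiffOn 𝓘(ℝ, E) (𝓘(ℝ, E).prod 𝓘(ℝ, E)) ∞
        (fun y ↦ TotalSpace.mk' E (E := fun x : M ↦ TangentSpace 𝓘(ℝ, E) x)
          (c.symm y) (chartDeriv x₀ y u)) c.target := by
      intro u
      have hmaps : Set.MapsTo (fun y ↦ TotalSpace.mk' E (E := fun x : M ↦ TangentSpace 𝓘(ℝ, E) x)
          (c.symm y) (chartDeriv x₀ y u)) c.target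
          (trivializationAt E (fun x : M ↦ TangentSpace 𝓘(ℝ, E) x) x₀).source := by
        intro y hy
        rw [Trivialization.mem_source]
        have := c.map_target hy
        rwa [extChartAt_source] at this
      rw [Trivialization.contMDiffOn_iff hmaps]
      refine ⟨hc, (contMDiffOn_const (c := u)).congr fun y hy ↦ ?_⟩
      exact trivializationAt_chartDeriv hy u
    have h := hg.clm_bundle_apply₂ (E₃ := fun _ : M ↦ ℝ) (hs u) (hs v)
    intro y hy
    have h1 := h y hy
    simp only [contMDiffWithinAt_totalSpace] at h1
    refine h1.2.contDiffWithinAt.congr (fun z hz ↦ ?_) ?_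
    · exact metricInChart_eq _ hz u v
    · exact metricInChart_eq _ hy u v

end Riemannian

section Riemannian

open Filter Topology LocalGeometry

variable {E : Type*} [NormedAddCommGroup E] [NormedSpace ℝ E]
  {M : Type*} [TopologicalSpace M] [ChartedSpace E M] [IsManifold 𝓘(ℝ, E) ∞ M]

theorem contDiffOn_comp_extChartAt_symm {k : M → ℝ} (hk : ContMDiff 𝓘(ℝ, E) 𝓘(ℝ) ∞ k) (x₀ : M) :
    ContDiffOn ℝ ∞ (k ∘ (extChartAt 𝓘(ℝ, E) x₀).symm) (extChartAt 𝓘(ℝ, E) x₀).target :=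
  (hk.comp_contMDiffOn (contMDiffOn_extChartAt_symm x₀)).contDiffOn

omit [IsManifold 𝓘(ℝ, E) ∞ M] in
theorem contMDiff_of_forall_chart {k : M → ℝ} (hk : ∀ x₀ : M, ContDiffOn ℝ ∞
    (k ∘ (extChartAt 𝓘(ℝ, E) x₀).symm) (extChartAt 𝓘(ℝ, E) x₀).target) :
    ContMDiff 𝓘(ℝ, E) 𝓘(ℝ) ∞ k := by
  intro x
  rw [contMDiffAt_iff_source, ModelWithCorners.range_eq_univ, contMDiffWithinAt_univ]
  exact ((hk x).contDiffAt (extChartAt_target_mem_nhds x)).contMDiffAt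

omit [IsManifold 𝓘(ℝ, E) ∞ M] in
theorem eventually_mem_chart {x₀ : M} {y : E} (hy : y ∈ (extChartAt 𝓘(ℝ, E) x₀).target) {x₁ : M}
    (hy' : (extChartAt 𝓘(ℝ, E) x₀).symm y ∈ (extChartAt 𝓘(ℝ, E) x₁).source) :
    ∀ᶠ y' in 𝓝 y, y' ∈ (extChartAt 𝓘(ℝ, E) x₀).target ∧
      (extChartAt 𝓘(ℝ, E) x₀).symm y' ∈ (extChartAt 𝓘(ℝ, E) x₁).source :=
  ((isOpen_extChartAt_target x₀).eventually_mem hy).and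
    ((continuousAt_extChartAt_symm'' hy).eventually ((isOpen_extChartAt_source x₁).mem_nhds hy'))

variable [FiniteDimensional ℝ E]
  (g : ContMDiffRiemannianMetric 𝓘(ℝ, E) ∞ E (fun x : M ↦ TangentSpace 𝓘(ℝ, E) x))
  {k : M → ℝ} (hk : ContMDiff 𝓘(ℝ, E) 𝓘(ℝ) ∞ k) {x₀ : M} {y : E}
  (hy : y ∈ (extChartAt 𝓘(ℝ, E) x₀).target)

include hk hy

/-- The gradient at a point is expressed in the preferred chart of that point, which varies with
`y`; `chartDeriv` translates from the fixed chart at `x₀`. -/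
theorem grad_eq_chartDeriv :
    @Eq E (grad g.inner k ((extChartAt 𝓘(ℝ, E) x₀).symm y))
      (chartDeriv x₀ y (coordGrad (metricInChart g.inner x₀) (k ∘ (extChartAt 𝓘(ℝ, E) x₀).symm) y)) := by
  have hb := isInner_inner g ((extChartAt 𝓘(ℝ, E) x₀).symm y)
  refine hb.inverse_eq_iff.2 fun w ↦ ?_
  obtain ⟨w, rfl⟩ := (isInvertible_chartDeriv hy).surjective w
  refine (metricInChart_eq g.inner hy _ w).symm.trans ?_
  rw [(isMetricOn_metricInChart g x₀).metric_gradient hy,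
    fderiv_comp_extChartAt_symm hy (hk.mdifferentiable (by simp) _)]
  rfl

theorem gradNormSq_eq : gradNormSq g.inner k ((extChartAt 𝓘(ℝ, E) x₀).symm y)
    = metricInChart g.inner x₀ y
      (coordGrad (metricInChart g.inner x₀) (k ∘ (extChartAt 𝓘(ℝ, E) x₀).symm) y)
      (coordGrad (metricInChart g.inner x₀) (k ∘ (extChartAt 𝓘(ℝ, E) x₀).symm) y) := by
  rw [metricInChart_eq g.inner hy, ← grad_eq_chartDeriv g hk hy]
  rfl

omit hy in
theorem grad_eq (x : M) : @Eq E (grad g.inner k x)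
    (coordGrad (metricInChart g.inner x) (k ∘ (extChartAt 𝓘(ℝ, E) x).symm)
      (extChartAt 𝓘(ℝ, E) x x)) := by
  have h := grad_eq_chartDeriv g hk (mem_extChartAt_target (I := 𝓘(ℝ, E)) x)
  rw [chartDeriv_self] at h
  refine Eq.trans ?_ h
  rw [(extChartAt 𝓘(ℝ, E) x).left_inv (mem_extChartAt_source x)]

/-- The global Laplacian uses a different chart at each point. Its expression in one fixed chart is
what allows it to be differentiated. -/
theorem laplacian_eq : laplacian g.inner k ((extChartAt 𝓘(ℝ, E) x₀).symm y)
    = LocalGeometry.laplacian (metricInChart g.inner x₀)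
      (k ∘ (extChartAt 𝓘(ℝ, E) x₀).symm) y := by
  set z := (extChartAt 𝓘(ℝ, E) x₀).symm y
  have hG := isMetricOn_metricInChart g x₀
  have hG' := isMetricOn_metricInChart g z
  have hzs : z ∈ (extChartAt 𝓘(ℝ, E) z).source := mem_extChartAt_source z
  have hψ : ContDiffAt ℝ ∞ (coordTransition x₀ z) y := contDiffAt_coordTransition hy hzs
  have hyz : coordTransition x₀ z y ∈ (extChartAt 𝓘(ℝ, E) z).target :=
    (extChartAt 𝓘(ℝ, E) z).map_source hzs
  have hev := eventually_mem_chart hy hzs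
  refine (laplacian_pullback hψ (isInvertible_chartDeriv hy) (hG.isInner y hy)
    (hG'.isInner _ hyz) (hG'.differentiableAt hyz) ?_ (hG.differentiableAt hy)
    ((contDiffOn_comp_extChartAt_symm hk z).contDiffAt (hG'.isOpen.mem_nhds hyz)) ?_).symm
  · filter_upwards [hev] with y' hy' u v
      using metricInChart_coordTransition g.inner hy'.1 hy'.2 u v
  · filter_upwards [hev] with y' hy'
    exact congrArg k ((extChartAt 𝓘(ℝ, E) z).left_inv hy'.2).symm

omit hk in
/-- The transformation law of the Christoffel symbols on a manifold. -/
theorem chartDeriv_christoffel (u v : E) :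
    chartDeriv x₀ y (christoffel (metricInChart g.inner x₀) y u v)
      = fderiv ℝ (fderiv ℝ (coordTransition x₀ ((extChartAt 𝓘(ℝ, E) x₀).symm y))) y u v
        + christoffelAt g.inner ((extChartAt 𝓘(ℝ, E) x₀).symm y) (chartDeriv x₀ y u)
          (chartDeriv x₀ y v) := by
  set z := (extChartAt 𝓘(ℝ, E) x₀).symm y
  have hG := isMetricOn_metricInChart g x₀
  have hG' := isMetricOn_metricInChart g z
  have hzs : z ∈ (extChartAt 𝓘(ℝ, E) z).source := mem_extChartAt_source z
  have hyz : coordTransition x₀ z y ∈ (extChartAt 𝓘(ℝ, E) z).target :=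
    (extChartAt 𝓘(ℝ, E) z).map_source hzs
  refine christoffel_pullback (contDiffAt_coordTransition hy hzs) (isInvertible_chartDeriv hy)
    (hG.isInner y hy).isInvertible (hG'.isInner _ hyz) (hG'.differentiableAt hyz) ?_
    (hG.differentiableAt hy) u v
  filter_upwards [eventually_mem_chart hy hzs] with y' hy' u v
    using metricInChart_coordTransition g.inner hy'.1 hy'.2 u v

end Riemannian

/-! ### Induced charts of the tangent bundle -/

section TangentBundle

open Filter Topology LocalGeometry

variable {E : Type*} [NormedAddCommGroup E] [NormedSpace ℝ E]
  {M : Type*} [TopologicalSpace M] [ChartedSpace E M] [IsManifold 𝓘(ℝ, E) ∞ M]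

theorem proj_extChartAt_symm (p : TangentBundle 𝓘(ℝ, E) M) (y : E × E) :
    ((extChartAt 𝓘(ℝ, E).tangent p).symm y).proj = (extChartAt 𝓘(ℝ, E) p.proj).symm y.1 := rfl

theorem snd_extChartAt_symm (p : TangentBundle 𝓘(ℝ, E) M) {y : E × E}
    (hy : y.1 ∈ (extChartAt 𝓘(ℝ, E) p.proj).target) :
    @Eq E ((extChartAt 𝓘(ℝ, E).tangent p).symm y).snd (chartDeriv p.proj y.1 y.2) := by
  have : IsManifold 𝓘(ℝ, E) 1 M := IsManifold.of_le (n := ∞) (by exact_mod_cast le_top)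
  have h : @Eq E ((extChartAt 𝓘(ℝ, E).tangent p).symm y).snd
      (tangentCoordChange 𝓘(ℝ, E) p.proj ((extChartAt 𝓘(ℝ, E) p.proj).symm y.1)
        ((extChartAt 𝓘(ℝ, E) p.proj).symm y.1) y.2) := rfl
  rw [h, tangentCoordChange_def, (extChartAt 𝓘(ℝ, E) p.proj).right_inv hy,
    ModelWithCorners.range_eq_univ, fderivWithin_univ]
  rfl

theorem extChartAt_tangent_target (p : TangentBundle 𝓘(ℝ, E) M) :
    (extChartAt 𝓘(ℝ, E).tangent p).target = (extChartAt 𝓘(ℝ, E) p.proj).target ×ˢ Set.univ := by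
  have h : (extChartAt 𝓘(ℝ, E).tangent p).target = _ :=
    FiberBundle.extChartAt_target (IB := 𝓘(ℝ, E)) (E := fun x : M ↦ TangentSpace 𝓘(ℝ, E) x) p
  have h' : (extChartAt 𝓘(ℝ, E) p.proj).target ⊆ (extChartAt 𝓘(ℝ, E) p.proj).symm ⁻¹'
      (trivializationAt E (fun x : M ↦ TangentSpace 𝓘(ℝ, E) x) p.proj).baseSet := by
    intro y hy
    have := (extChartAt 𝓘(ℝ, E) p.proj).map_target hy
    rwa [extChartAt_source] at this
  rw [h, Set.inter_eq_left.2 h']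

/-- Induced charts change by the tangent map of the base transition; this is the cocycle identity
for tangent coordinate changes. -/
theorem coordTransition_tangent (p q : TangentBundle 𝓘(ℝ, E) M) {y : E × E}
    (hy : y.1 ∈ (extChartAt 𝓘(ℝ, E) p.proj).target)
    (hy' : (extChartAt 𝓘(ℝ, E) p.proj).symm y.1 ∈ (extChartAt 𝓘(ℝ, E) q.proj).source) :
    extChartAt 𝓘(ℝ, E).tangent q ((extChartAt 𝓘(ℝ, E).tangent p).symm y)
      = (coordTransition p.proj q.proj y.1, fderiv ℝ (coordTransition p.proj q.proj) y.1 y.2) := by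
  have : IsManifold 𝓘(ℝ, E) 1 M := IsManifold.of_le (n := ∞) (by exact_mod_cast le_top)
  set z := (extChartAt 𝓘(ℝ, E) p.proj).symm y.1
  have h := tangentCoordChange_comp (I := 𝓘(ℝ, E)) (w := p.proj) (x := z) (y := q.proj) (z := z)
    (v := y.2) ⟨⟨(extChartAt 𝓘(ℝ, E) p.proj).map_target hy, mem_extChartAt_source _⟩, hy'⟩
  rw [tangentCoordChange_def (x := p.proj) (y := q.proj),
    (extChartAt 𝓘(ℝ, E) p.proj).right_inv hy, ModelWithCorners.range_eq_univ,
    fderivWithin_univ] at h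
  exact Prod.ext rfl h

/-- The derivative of a coordinate change of the tangent bundle. -/
theorem mfderivWithin_extChartAt_symm_tangent (p : TangentBundle 𝓘(ℝ, E) M) {y : E × E}
    (hy : y.1 ∈ (extChartAt 𝓘(ℝ, E) p.proj).target) (ξ : E × E) :
    @Eq (E × E) (mfderivWithin 𝓘(ℝ, E × E) 𝓘(ℝ, E).tangent (extChartAt 𝓘(ℝ, E).tangent p).symm
      (Set.range 𝓘(ℝ, E).tangent) y ξ)
      (chartDeriv p.proj y.1 ξ.1,
        fderiv ℝ (fderiv ℝ (coordTransition p.proj ((extChartAt 𝓘(ℝ, E) p.proj).symm y.1)))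
          y.1 ξ.1 y.2 + chartDeriv p.proj y.1 ξ.2) := by
  set z := (extChartAt 𝓘(ℝ, E) p.proj).symm y.1
  have hyt : y ∈ (extChartAt 𝓘(ℝ, E).tangent p).target := by
    rw [extChartAt_tangent_target]
    exact ⟨hy, trivial⟩
  have h1 := mfderivWithin_extChartAt_symm_eq_fderivWithin (I := 𝓘(ℝ, E).tangent) hyt
  have hzs : z ∈ (extChartAt 𝓘(ℝ, E) z).source := mem_extChartAt_source z
  have hψ := contDiffAt_coordTransition (x₀ := p.proj) (x₁ := z) hy hzs
  set ψ : E → E := coordTransition p.proj z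
  have hψ₁ : DifferentiableAt ℝ ψ y.1 := hψ.differentiableAt (by simp)
  have hψ₂ : DifferentiableAt ℝ (fderiv ℝ ψ) y.1 :=
    (hψ.fderiv_right (m := 1) (WithTop.coe_le_coe.2 le_top)).differentiableAt (by simp)
  have h2 : (extChartAt 𝓘(ℝ, E).tangent ((extChartAt 𝓘(ℝ, E).tangent p).symm y) ∘
      (extChartAt 𝓘(ℝ, E).tangent p).symm) =ᶠ[𝓝 y] fun y' ↦ (ψ y'.1, fderiv ℝ ψ y'.1 y'.2) := by
    have hev := continuousAt_fst.eventually (eventually_mem_chart (x₀ := p.proj) (x₁ := z) hy hzs)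
    filter_upwards [hev] with y' hy'
    exact coordTransition_tangent p ((extChartAt 𝓘(ℝ, E).tangent p).symm y) hy'.1 hy'.2
  have h3 : DifferentiableAt ℝ (fun y' : E × E ↦ ψ y'.1) y := hψ₁.comp y differentiableAt_fst
  have h4 : DifferentiableAt ℝ (fun y' : E × E ↦ fderiv ℝ ψ y'.1) y :=
    hψ₂.comp y differentiableAt_fst
  refine (congrArg (fun t : E × E →L[ℝ] E × E ↦ t ξ) h1).trans ?_
  rw [ModelWithCorners.range_eq_univ, fderivWithin_univ, h2.fderiv_eq,
    h3.fderiv_prodMk (h4.clm_apply differentiableAt_snd)]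
  refine Prod.ext (fderiv_comp_fst hψ₁ ξ) ?_
  refine (fderiv_apply₁ h4 differentiableAt_snd ξ).trans ?_
  rw [fderiv_comp_fst hψ₂, fderiv_snd]
  rfl

variable [FiniteDimensional ℝ E]
  (g : ContMDiffRiemannianMetric 𝓘(ℝ, E) ∞ E (fun x : M ↦ TangentSpace 𝓘(ℝ, E) x))

/-- The Mus-Gradient metric in an induced chart of the tangent bundle. -/
theorem metricInChart_musGradient {f : M → ℝ} (hf : ContMDiff 𝓘(ℝ, E) 𝓘(ℝ) ∞ f)
    (p : TangentBundle 𝓘(ℝ, E) M) {y : E × E} (hy : y.1 ∈ (extChartAt 𝓘(ℝ, E) p.proj).target) :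
    metricInChart (musGradient g.inner f) p y
      = tangentMetric (metricInChart g.inner p.proj)
        (f ∘ (extChartAt 𝓘(ℝ, E) p.proj).symm) y := by
  refine ContinuousLinearMap.ext fun ξ ↦ ContinuousLinearMap.ext fun η ↦ ?_
  have h1 : ∀ (q : TangentBundle 𝓘(ℝ, E) M) (ξ η : E × E), musGradient g.inner f q ξ η
      = formAt g.inner q.proj ξ.1 η.1
        + (formAt g.inner q.proj (ξ.2 + christoffelAt g.inner q.proj ξ.1 q.snd)
            (η.2 + christoffelAt g.inner q.proj η.1 q.snd)
          + differentialAt 𝓘(ℝ, E) f q.proj (ξ.2 + christoffelAt g.inner q.proj ξ.1 q.snd)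
            * differentialAt 𝓘(ℝ, E) f q.proj (η.2 + christoffelAt g.inner q.proj η.1 q.snd)) :=
    fun _ _ _ ↦ rfl
  -- The second derivative of the transition map in the fibre component is exactly the inhomogeneous
  -- term of the Christoffel law, so vertical parts transform by `chartDeriv` alone.
  have h2 : ∀ ξ : E × E, fderiv ℝ (fderiv ℝ (coordTransition p.proj
      ((extChartAt 𝓘(ℝ, E) p.proj).symm y.1))) y.1 ξ.1 y.2 + chartDeriv p.proj y.1 ξ.2
      + christoffelAt g.inner ((extChartAt 𝓘(ℝ, E) p.proj).symm y.1) (chartDeriv p.proj y.1 ξ.1)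
        (chartDeriv p.proj y.1 y.2)
      = chartDeriv p.proj y.1 (ξ.2 + christoffel (metricInChart g.inner p.proj) y.1 ξ.1 y.2) := by
    intro ξ
    rw [map_add, chartDeriv_christoffel g hy]
    abel
  refine (congrArg₂ (fun a b : E × E ↦
    musGradient g.inner f ((extChartAt 𝓘(ℝ, E).tangent p).symm y) a b)
    (mfderivWithin_extChartAt_symm_tangent p hy ξ)
    (mfderivWithin_extChartAt_symm_tangent p hy η)).trans ((h1 _ _ _).trans ?_)
  simp only [snd_extChartAt_symm p hy, proj_extChartAt_symm, h2]
  rw [tangentMetric_apply, gradMetric_apply, metricInChart_eq g.inner hy,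
    metricInChart_eq g.inner hy, fderiv_comp_extChartAt_symm hy (hf.mdifferentiable (by simp) _),
    fderiv_comp_extChartAt_symm hy (hf.mdifferentiable (by simp) _)]

end TangentBundle

/-! ### Bitension field of the projection on the manifold -/

section Projection

open Filter Topology LocalGeometry

theorem LocalGeometry.coordGrad_congr {E : Type*} [NormedAddCommGroup E] [NormedSpace ℝ E]
    {G : E → E →L[ℝ] E →L[ℝ] ℝ} {U : Set E} (hU : IsOpen U) {k k' : E → ℝ} (h : Set.EqOn k k' U)
    {y : E} (hy : y ∈ U) : coordGrad G k y = coordGrad G k' y := by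
  rw [coordGrad, coordGrad, fderiv_eq_of_eqOn hU h hy]

theorem LocalGeometry.laplacian_congr {E : Type*} [NormedAddCommGroup E] [NormedSpace ℝ E]
    [FiniteDimensional ℝ E] {G : E → E →L[ℝ] E →L[ℝ] ℝ} {U : Set E} (hU : IsOpen U) {k k' : E → ℝ}
    (h : Set.EqOn k k' U) {y : E} (hy : y ∈ U) :
    LocalGeometry.laplacian G k y = LocalGeometry.laplacian G k' y := by
  have h1 : Set.EqOn (fderiv ℝ k) (fderiv ℝ k') U := fun z hz ↦ fderiv_eq_of_eqOn hU h hz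
  simp only [LocalGeometry.laplacian, fderiv_eq_of_eqOn hU h1 hy, h1 hy]

theorem LocalGeometry.IsMetricOn.contDiffOn_laplacian {E : Type*} [NormedAddCommGroup E]
    [NormedSpace ℝ E] [FiniteDimensional ℝ E] {G : E → E →L[ℝ] E →L[ℝ] ℝ} {U : Set E}
    (hG : IsMetricOn G U) {k : E → ℝ} (hk : ContDiffOn ℝ ∞ k U) :
    ContDiffOn ℝ ∞ (LocalGeometry.laplacian G k) U := by
  have h : ∀ i ∈ Finset.univ, ContDiffOn ℝ ∞ (fun y ↦ hessian G k y (Module.finBasis ℝ E i)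
      ((G y).inverse (LinearMap.toContinuousLinearMap ((Module.finBasis ℝ E).coord i)))) U :=
    fun _ _ ↦ ((hG.contDiffOn_hessian hk).clm_apply contDiffOn_const).clm_apply
      (hG.contDiffOn_inverse.clm_apply contDiffOn_const)
  exact ContDiffOn.sum h

variable {E : Type*} [NormedAddCommGroup E] [NormedSpace ℝ E]
  {M : Type*} [TopologicalSpace M] [ChartedSpace E M] [IsManifold 𝓘(ℝ, E) ∞ M]

theorem eventually_mem_target (p : TangentBundle 𝓘(ℝ, E) M) :
    ∀ᶠ y : E × E in 𝓝 (extChartAt 𝓘(ℝ, E).tangent p p),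
      y.1 ∈ (extChartAt 𝓘(ℝ, E) p.proj).target :=
  continuousAt_fst.eventually ((isOpen_extChartAt_target p.proj).eventually_mem
    (mem_extChartAt_target p.proj))

theorem writtenInExtChartAt_proj (p : TangentBundle 𝓘(ℝ, E) M) :
    writtenInExtChartAt 𝓘(ℝ, E).tangent 𝓘(ℝ, E) p
        (TotalSpace.proj : TangentBundle 𝓘(ℝ, E) M → M)
      =ᶠ[𝓝 (extChartAt 𝓘(ℝ, E).tangent p p)] (Prod.fst : E × E → E) := by
  filter_upwards [eventually_mem_target p] with y hy
  exact (extChartAt 𝓘(ℝ, E) p.proj).right_inv hy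

variable [FiniteDimensional ℝ E]
  (g : ContMDiffRiemannianMetric 𝓘(ℝ, E) ∞ E (fun x : M ↦ TangentSpace 𝓘(ℝ, E) x))
  {f : M → ℝ} (hf : ContMDiff 𝓘(ℝ, E) 𝓘(ℝ) ∞ f) {k : M → ℝ}

theorem contMDiff_gradNormSq (hk : ContMDiff 𝓘(ℝ, E) 𝓘(ℝ) ∞ k) :
    ContMDiff 𝓘(ℝ, E) 𝓘(ℝ) ∞ (gradNormSq g.inner k) := by
  refine contMDiff_of_forall_chart fun x₀ ↦ ?_
  have hG := isMetricOn_metricInChart g x₀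
  have h := hG.contDiffOn_gradient (contDiffOn_comp_extChartAt_symm hk x₀)
  exact ((hG.contDiffOn.clm_apply h).clm_apply h).congr fun y hy ↦ gradNormSq_eq g hk hy

theorem contMDiff_laplacian (hk : ContMDiff 𝓘(ℝ, E) 𝓘(ℝ) ∞ k) :
    ContMDiff 𝓘(ℝ, E) 𝓘(ℝ) ∞ (laplacian g.inner k) := by
  refine contMDiff_of_forall_chart fun x₀ ↦ ?_
  exact ((isMetricOn_metricInChart g x₀).contDiffOn_laplacian
    (contDiffOn_comp_extChartAt_symm hk x₀)).congr fun y hy ↦ laplacian_eq g hk hy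

include hf

theorem metricInChart_musGradient_eventuallyEq (p : TangentBundle 𝓘(ℝ, E) M) :
    (metricInChart (musGradient g.inner f) p : E × E → E × E →L[ℝ] E × E →L[ℝ] ℝ)
      =ᶠ[𝓝 (extChartAt 𝓘(ℝ, E).tangent p p)] tangentMetric (metricInChart g.inner p.proj)
        (f ∘ (extChartAt 𝓘(ℝ, E) p.proj).symm) := by
  filter_upwards [eventually_mem_target p] with y hy using metricInChart_musGradient g hf p hy

theorem log_gradDensity_eq (x₀ : M) : Set.EqOn
    (fun y ↦ Real.log (gradDensity (metricInChart g.inner x₀)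
      (f ∘ (extChartAt 𝓘(ℝ, E) x₀).symm) y))
    ((fun x ↦ Real.log (1 + gradNormSq g.inner f x)) ∘ (extChartAt 𝓘(ℝ, E) x₀).symm)
    (extChartAt 𝓘(ℝ, E) x₀).target := by
  intro y hy
  simp only [Function.comp_apply, gradDensity]
  rw [gradNormSq_eq g hf hy]

theorem contMDiff_log_gradNormSq :
    ContMDiff 𝓘(ℝ, E) 𝓘(ℝ) ∞ fun x ↦ Real.log (1 + gradNormSq g.inner f x) :=
  contMDiff_of_forall_chart fun x₀ ↦
    ((isMetricOn_metricInChart g x₀).contDiffOn_log_gradDensity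
      (contDiffOn_comp_extChartAt_symm hf x₀)).congr (log_gradDensity_eq g hf x₀).symm

/-- The tension field of `π : (TM, g^f) → (M, g)` is `½ grad ln α`. -/
theorem tension_proj (p : TangentBundle 𝓘(ℝ, E) M) :
    @Eq E (tension (musGradient g.inner f) g.inner
        (TotalSpace.proj : TangentBundle 𝓘(ℝ, E) M → M) p)
      ((1 / 2 : ℝ) • (show E from
        grad g.inner (fun x ↦ Real.log (1 + gradNormSq g.inner f x)) p.proj)) := by
  have hG := isMetricOn_metricInChart g p.proj
  have hx : (extChartAt 𝓘(ℝ, E).tangent p p : E × E).1 ∈ (extChartAt 𝓘(ℝ, E) p.proj).target :=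
    mem_extChartAt_target p.proj
  refine (hG.tension_fst (contDiffOn_comp_extChartAt_symm hf p.proj) hx
    (metricInChart_musGradient_eventuallyEq g hf p) (writtenInExtChartAt_proj p)).trans ?_
  refine congrArg ((1 / 2 : ℝ) • · : E → E) ?_
  refine Eq.trans ?_ (grad_eq g (contMDiff_log_gradNormSq g hf) p.proj).symm
  exact coordGrad_congr hG.isOpen (log_gradDensity_eq g hf p.proj) hx

/-- The bitension field of `π : (TM, g^f) → (M, g)`. -/
theorem bitension_proj (p : TangentBundle 𝓘(ℝ, E) M) (l : M → ℝ)
    (hl : l = fun x ↦ Real.log (1 + gradNormSq g.inner f x)) :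
    bitension (musGradient g.inner f) g.inner (TotalSpace.proj : TangentBundle 𝓘(ℝ, E) M → M) p
      = - (ricci g.inner p.proj (grad g.inner l p.proj)
          + (1 / 2 : ℝ) • grad g.inner (laplacian g.inner l) p.proj
          + (1 / 8 : ℝ) • grad g.inner (gradNormSq g.inner l) p.proj) := by
  have hG := isMetricOn_metricInChart g p.proj
  have hx : (extChartAt 𝓘(ℝ, E).tangent p p : E × E).1 ∈ (extChartAt 𝓘(ℝ, E) p.proj).target :=
    mem_extChartAt_target p.proj
  have hlc : ContMDiff 𝓘(ℝ, E) 𝓘(ℝ) ∞ l := hl ▸ contMDiff_log_gradNormSq g hf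
  have heq := log_gradDensity_eq g hf p.proj
  rw [← hl] at heq
  set c := extChartAt 𝓘(ℝ, E) p.proj
  set G := metricInChart g.inner p.proj
  set L := fun y ↦ Real.log (gradDensity G (f ∘ c.symm) y)
  have hgrad : Set.EqOn (coordGrad G L) (coordGrad G (l ∘ c.symm)) c.target :=
    fun y hy ↦ coordGrad_congr hG.isOpen heq hy
  -- At each nearby point the tension field is `½ grad l` in that point's own chart; the
  -- differential of the fixed chart undoes `chartDeriv` and gives its components in the chart at
  -- `p.proj`.
  have hV : alongInChart 𝓘(ℝ, E).tangent 𝓘(ℝ, E) (TotalSpace.proj : TangentBundle 𝓘(ℝ, E) M → M)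
      (tension (musGradient g.inner f) g.inner TotalSpace.proj) p
      =ᶠ[𝓝 (extChartAt 𝓘(ℝ, E).tangent p p)] fun q : E × E ↦ (1 / 2 : ℝ) • coordGrad G L q.1 := by
    filter_upwards [eventually_mem_target p] with y hy
    have h1 := tension_proj g hf ((extChartAt 𝓘(ℝ, E).tangent p).symm y)
    rw [← hl] at h1
    have h2 := grad_eq_chartDeriv g hlc hy
    rw [hgrad hy]
    have h3 := mfderiv_extChartAt_chartDeriv hy ((1 / 2 : ℝ) • coordGrad G (l ∘ c.symm) y.1)
    rw [map_smul] at h3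
    exact (congrArg (mfderiv 𝓘(ℝ, E) 𝓘(ℝ, E) c (c.symm y.1) : E →L[ℝ] E)
      (h1.trans (congrArg ((1 / 2 : ℝ) • · : E → E) h2))).trans h3
  have h := hG.jacobi_tension_fst (contDiffOn_comp_extChartAt_symm hf p.proj) hx
    (metricInChart_musGradient_eventuallyEq g hf p) (writtenInExtChartAt_proj p) hV
  have e₁ : @Eq E (coordGrad G L (c p.proj)) (grad g.inner l p.proj) :=
    (hgrad hx).trans (grad_eq g hlc p.proj).symm
  have e₂ : @Eq E (coordGrad G (LocalGeometry.laplacian G L) (c p.proj))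
      (grad g.inner (laplacian g.inner l) p.proj) := by
    refine (coordGrad_congr hG.isOpen (fun y hy ↦ ?_) hx).trans
      (grad_eq g (contMDiff_laplacian g hlc) p.proj).symm
    exact (laplacian_congr hG.isOpen heq hy).trans (laplacian_eq g hlc hy).symm
  have e₃ : @Eq E (coordGrad G (fun y ↦ G y (coordGrad G L y) (coordGrad G L y)) (c p.proj))
      (grad g.inner (gradNormSq g.inner l) p.proj) := by
    refine (coordGrad_congr hG.isOpen (fun y hy ↦ ?_) hx).trans
      (grad_eq g (contMDiff_gradNormSq g hlc) p.proj).symm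
    refine Eq.trans ?_ (gradNormSq_eq g hlc hy).symm
    simp only [hgrad hy]
    rfl
  have hsum : ∀ {a b d a' b' d' : E}, a = a' → b = b' → d = d' →
      - (LocalGeometry.ricci G (c p.proj) a + (1 / 2 : ℝ) • b + (1 / 8 : ℝ) • d)
        = - (LocalGeometry.ricci G (c p.proj) a' + (1 / 2 : ℝ) • b' + (1 / 8 : ℝ) • d') := by
    rintro a b d _ _ _ rfl rfl rfl
    rfl
  exact h.trans (hsum e₁ e₂ e₃)

end Projection

end

theorem theorem4p2
    {E : Type*} [NormedAddCommGroup E] [NormedSpace ℝ E] [FiniteDimensional ℝ E]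
    {M : Type*} [TopologicalSpace M] [ChartedSpace E M] [IsManifold 𝓘(ℝ, E) ∞ M]
    (g : ContMDiffRiemannianMetric 𝓘(ℝ, E) ∞ E (fun x : M ↦ TangentSpace 𝓘(ℝ, E) x))
    (f : M → ℝ) (hf : ContMDiff 𝓘(ℝ, E) 𝓘(ℝ) ∞ f) (hf_pos : ∀ x, 0 < f x)
    (hf_grad : ∀ x, grad g.inner f x ≠ 0)
    (α : M → ℝ) (hα : ∀ x, α x = 1 + gradNormSq g.inner f x) :
    IsBiharmonic (musGradient g.inner f) g.inner
        (TotalSpace.proj : TangentBundle 𝓘(ℝ, E) M → M) ↔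
      ∀ x : M,
        ricci g.inner x (grad g.inner (fun z ↦ Real.log (α z)) x)
          + (1 / 2 : ℝ) • grad g.inner (laplacian g.inner (fun z ↦ Real.log (α z))) x
          + (1 / 8 : ℝ) • grad g.inner (gradNormSq g.inner (fun z ↦ Real.log (α z))) x = 0 := by
  have hl : (fun z ↦ Real.log (α z)) = fun x ↦ Real.log (1 + gradNormSq g.inner f x) := by
    simp only [hα]
  have key := fun p ↦ bitension_proj g hf p _ hl
  constructor
  · rintro ⟨-, h⟩ x
    -- The bitension field depends only on the base point, so any vector over `x` will do; the zero
    -- vector is one.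
    have h1 := h (TotalSpace.mk' E x (0 : TangentSpace 𝓘(ℝ, E) x))
    rw [key] at h1
    exact neg_eq_zero.1 h1
  · intro h
    refine ⟨contMDiff_proj _, fun p ↦ ?_⟩
    rw [key, h]
    exact neg_zero
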